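/- Let $p$ be a prime and $S$ a finite $p$-group. A fusion system $\mathcal F$ on $S$ is a category whose objects are the subgroups of $S$ and whose morphisms $P\to Q$ are injective group homomorphisms, including all the maps $x\mapsto g^{-1}xg$ with $g\in S$, $g^{-1}Pg\le Q$, such that every morphism $P\to Q$ is an isomorphism of $\mathcal F$ from $P$ onto its image followed by the inclusion of the image into $Q$. Write $P^{\mathcal F}$ for the set of images of $P$ under morphisms in $\operatorname{Hom}_{\mathcal F}(P,S)$; its members are the $\mathcal F$-conjugates of $P$. Let $\operatorname{Aut}_{\mathcal F}(P)=\operatorname{Hom}_{\mathcal F}(P,P)$, let $\operatorname{Out}_{\mathcal F}(P)=\operatorname{Aut}_{\mathcal F}(P)/\operatorname{Inn}(P)$, and let $\operatorname{Aut}_S(P)$ be the group of automorphisms of $P$ induced by conjugation with elements of $N_S(P)$. The system $\mathcal F$ is saturated if every subgroup of $S$ has an $\mathcal F$-conjugate $Q$ such that $\operatorname{Aut}_S(Q)$ is a Sylow $p$-subgroup of $\operatorname{Aut}_{\mathcal F}(Q)$ and every $\mathcal F$-isomorphism $\alpha\colon R\to Q$, with $R\le S$, extends to a morphism in $\operatorname{Hom}_{\mathcal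 F}(N_\alpha,S)$, where $N_\alpha$ is the group of all $g\in N_S(R)$ such that conjugation with $g$ on $R$, transported to $Q$ by $\alpha$, lies in $\operatorname{Aut}_S(Q)$. A subgroup $Q\le S$ is $S$-centric if $C_S(Q)=Z(Q)$. A subgroup $P<S$ is $\mathcal F$-essential if every member of $P^{\mathcal F}$ is $S$-centric, $|N_S(P)|\ge|N_S(Q)|$ for all $Q\in P^{\mathcal F}$, and $\operatorname{Out}_{\mathcal F}(P)$ has a strongly $p$-embedded subgroup, that is, a proper subgroup $M$ of order divisible by $p$ such that $p\nmid|M\cap gMg^{-1}|$ for all $g\in\operatorname{Out}_{\mathcal F}(P)\setminus M$. For $P<S$ let $H_{\mathcal F}(P)\le\operatorname{Aut}_{\mathcal F}(P)$ be the subgroup generated by those $\mathcal F$-automorphisms of $P$ which extend to $\mathcal F$-isomorphisms between subgroups of $S$ strictly larger than $P$. **Lemma.** Let $\mathcal F$ be a saturated fusion system on $S$ and let $P$ be an $\mathcal F$-essential subgroup of $S$. Let $\mathcal C$ be a set of $\mathcal F$-conjugacy class representatives of $\mathcal F$-essential subgroups (that is, $\mathcal C$ consists of $\mathcal F$-essential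 subgroups, and every $\mathcal F$-essential subgroup is $\mathcal F$-conjugate to exactly one member of $\mathcal C$) with $P\in\mathcal C$. Assume that no proper subgroup of $P$ is $S$-centric. If $H_{\mathcal F}(P)\le K\le\operatorname{Aut}_{\mathcal F}(P)$, then the smallest fusion system on $S$ containing the indicated automorphisms, $$\mathcal G=\langle \operatorname{Aut}_{\mathcal F}(S),\,K,\,\operatorname{Aut}_{\mathcal F}(E)\mid E\in\mathcal C\setminus\{P\}\rangle,$$ is saturated. Furthermore, $P$ is $\mathcal G$-essential if and only if $K>H_{\mathcal F}(P)$, and in this case $\operatorname{Aut}_{\mathcal G}(P)=K$. -/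

import Mathlib

/-- A fusion system on a group `S`: a category whose objects are the subgroups of `S` and whose
morphisms are injective group homomorphisms, containing all the maps `x ↦ g⁻¹ x g` between
subgroups, and such that every morphism `P → Q` is an isomorphism of the category onto a subgroup
`R ≤ Q` (necessarily its image), followed by the inclusion. Identities and inclusions are morphisms
by `conj_mem` with `g = 1`. -/
structure FusionSystem (S : Type*) [Group S] where
  /-- the set of morphisms from `P` to `Q` -/
  Hom : (P Q : Subgroup S) → Set (P →* Q)
  injective : ∀ {P Q : Subgroup S} {φ : P →* Q}, φ ∈ Hom P Q → Function.Injective φ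
  comp_mem : ∀ {P Q R : Subgroup S} {φ : P →* Q} {ψ : Q →* R},
    φ ∈ Hom P Q → ψ ∈ Hom Q R → ψ.comp φ ∈ Hom P R
  conj_mem : ∀ {P Q : Subgroup S} (φ : P →* Q) (g : S),
    (∀ x : P, (φ x : S) = g⁻¹ * (x : S) * g) → φ ∈ Hom P Q
  factor : ∀ {P Q : Subgroup S} {φ : P →* Q}, φ ∈ Hom P Q →
    ∃ (R : Subgroup S) (hR : R ≤ Q) (e : P ≃* R),
      e.toMonoidHom ∈ Hom P R ∧ e.symm.toMonoidHom ∈ Hom R P ∧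
        φ = (Subgroup.inclusion hR).comp e.toMonoidHom

/-- `M` is a strongly `p`-embedded subgroup of `G`. -/
def IsStronglyPEmbedded (p : ℕ) {G : Type*} [Group G] (M : Subgroup G) : Prop :=
  M < ⊤ ∧ p ∣ Nat.card M ∧
    ∀ g : G, g ∉ M → ¬ p ∣ Nat.card (M ⊓ M.map (MulAut.conj g).toMonoidHom : Subgroup G)

namespace FusionSystem

variable {S : Type*} [Group S]

theorem symm_mem (F : FusionSystem S) {P Q : Subgroup S} {e : P ≃* Q}
    (he : e.toMonoidHom ∈ F.Hom P Q) : e.symm.toMonoidHom ∈ F.Hom Q P := by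
  obtain ⟨R, hR, e', -, h2, h3⟩ := F.factor he
  have key : ∀ x, e x = Subgroup.inclusion hR (e' x) := fun x => DFunLike.congr_fun h3 x
  have hRQ : R = Q := by
    refine le_antisymm hR fun y hy => ?_
    have h := key (e.symm ⟨y, hy⟩)
    rw [MulEquiv.apply_symm_apply] at h
    have h' : y = (e' (e.symm ⟨y, hy⟩) : S) := congrArg Subtype.val h
    rw [h']
    exact (e' _).2
  subst hRQ
  have : e = e' := MulEquiv.ext fun x => key x
  rw [this]
  exact h2

/-- `Aut_F(P)`, as a group of automorphisms of `P`. -/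
def Aut (F : FusionSystem S) (P : Subgroup S) : Subgroup (MulAut P) where
  carrier := {α | (MulEquiv.toMonoidHom α) ∈ F.Hom P P}
  one_mem' := F.conj_mem _ 1 fun x => by simp
  mul_mem' := fun {_ _} ha hb => F.comp_mem hb ha
  inv_mem' := fun {_} ha => F.symm_mem ha

/-- The intersection of a family of fusion systems on `S` (the system of all injective
homomorphisms if the family is empty). -/
def inter (X : Set (FusionSystem S)) : FusionSystem S where
  Hom P Q := {φ | Function.Injective φ ∧ ∀ G ∈ X, φ ∈ G.Hom P Q}
  injective h := h.1
  comp_mem h₁ h₂ := ⟨h₂.1.comp h₁.1, fun G hG => G.comp_mem (h₁.2 G hG) (h₂.2 G hG)⟩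
  conj_mem φ g h := by
    refine ⟨fun x y hxy => ?_, fun G _ => G.conj_mem φ g h⟩
    have h1 : (φ x : S) = φ y := by rw [hxy]
    rw [h, h] at h1
    exact Subtype.ext (mul_left_cancel (mul_right_cancel h1))
  factor {P Q φ} h := by
    have hφ : Function.Injective (Q.subtype.comp φ) := Q.subtype_injective.comp h.1
    have hR : (Q.subtype.comp φ).range ≤ Q := by
      rintro _ ⟨x, rfl⟩
      exact (φ x).2
    have key : ∀ G ∈ X, (MonoidHom.ofInjective hφ).toMonoidHom ∈
        G.Hom P (Q.subtype.comp φ).range := by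
      intro G hG
      obtain ⟨R, hRQ, e, h1, -, h3⟩ := G.factor (h.2 G hG)
      have hRR : R = (Q.subtype.comp φ).range := by
        ext y
        constructor
        · intro hy
          refine ⟨e.symm ⟨y, hy⟩, ?_⟩
          rw [h3]
          simp
        · rintro ⟨x, rfl⟩
          rw [h3]
          exact (e x).2
      subst hRR
      have : MonoidHom.ofInjective hφ = e :=
        MulEquiv.ext fun x => Subtype.ext (congrArg Subtype.val (DFunLike.congr_fun h3 x) :)
      rw [this]
      exact h1
    refine ⟨_, hR, MonoidHom.ofInjective hφ, ⟨(MonoidHom.ofInjective hφ).injective, key⟩,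
      ⟨(MonoidHom.ofInjective hφ).symm.injective, fun G hG => G.symm_mem (key G hG)⟩, ?_⟩
    ext x
    rfl

/-- The fusion system on `S` generated by a set `X` of automorphisms of subgroups of `S`: the
smallest fusion system on `S` in which all members of `X` are morphisms. -/
def generate (X : Set (Σ Q : Subgroup S, MulAut Q)) : FusionSystem S :=
  inter {G | ∀ x ∈ X, x.2 ∈ G.Aut x.1}

/-- `Aut_S(P)`: the automorphisms of `P` induced by conjugation with elements of `N_S(P)`. -/
def autS (P : Subgroup S) : Subgroup (MulAut P) :=
  P.normalizerMonoidHom.range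

/-- `Inn(P)`. -/
def inn (P : Subgroup S) : Subgroup (MulAut P) :=
  (MulAut.conj : P →* MulAut P).range

instance inn_normal (P : Subgroup S) : (inn P).Normal where
  conj_mem := by
    rintro _ ⟨x, rfl⟩ α
    refine ⟨α x, ?_⟩
    ext y
    simp

/-- `Out_F(P) = Aut_F(P) / Inn(P)`. -/
abbrev Out (F : FusionSystem S) (P : Subgroup S) : Type _ :=
  F.Aut P ⧸ (inn P).subgroupOf (F.Aut P)

/-- `P` and `Q` are `F`-conjugate: `Q` is the image of `P` under a morphism of `F`. -/
def IsConj (F : FusionSystem S) (P Q : Subgroup S) : Prop :=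
  ∃ e : P ≃* Q, e.toMonoidHom ∈ F.Hom P Q

def IsFullyNormalized (F : FusionSystem S) (P : Subgroup S) : Prop :=
  ∀ Q : Subgroup S, F.IsConj P Q →
    Nat.card (Subgroup.normalizer (Q : Set S)) ≤ Nat.card (Subgroup.normalizer (P : Set S))

/-- `Aut_S(P)` is a Sylow `p`-subgroup of `Aut_F(P)`. -/
def IsFullyAutomized (p : ℕ) (F : FusionSystem S) (P : Subgroup S) : Prop :=
  ∃ T : Sylow p (F.Aut P), (T : Subgroup (F.Aut P)).map (F.Aut P).subtype = autS P

/-- `P` is `S`-centric: `C_S(P) = Z(P)`. -/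
def IsSCentric (P : Subgroup S) : Prop :=
  Subgroup.centralizer (P : Set S) = (Subgroup.center P).map P.subtype

def IsCentric (F : FusionSystem S) (P : Subgroup S) : Prop :=
  ∀ Q : Subgroup S, F.IsConj P Q → IsSCentric Q

/-- For an isomorphism `e : P → Q`, the group of all `g ∈ N_S(P)` for which conjugation with `g`
on `P`, transported to `Q` along `e`, lies in `Aut_S(Q)`. -/
def extControl {P Q : Subgroup S} (e : P ≃* Q) : Subgroup S :=
  ((autS Q).comap ((MulAut.congr e).toMonoidHom.comp P.normalizerMonoidHom)).map
    (Subgroup.normalizer (P : Set S)).subtype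

theorem le_extControl {P Q : Subgroup S} (e : P ≃* Q) : P ≤ extControl e := by
  intro x hx
  refine ⟨⟨x, Subgroup.le_normalizer hx⟩,
    ⟨⟨e ⟨x, hx⟩, Subgroup.le_normalizer (e ⟨x, hx⟩).2⟩, ?_⟩, rfl⟩
  ext y
  have h : (⟨x, hx⟩ : P) * e.symm y * (⟨x, hx⟩ : P)⁻¹ =
      P.normalizerMonoidHom ⟨x, Subgroup.le_normalizer hx⟩ (e.symm y) := by
    ext
    rfl
  change _ = ((e (P.normalizerMonoidHom ⟨x, Subgroup.le_normalizer hx⟩ (e.symm y)) : Q) : S)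
  rw [← h]
  simp only [map_mul, map_inv, MulEquiv.apply_symm_apply]
  rfl

/-- Every `F`-isomorphism `e : P → Q` extends to an `F`-morphism `N_e → S`. -/
def IsReceptive (F : FusionSystem S) (Q : Subgroup S) : Prop :=
  ∀ (P : Subgroup S) (e : P ≃* Q), e.toMonoidHom ∈ F.Hom P Q →
    ∃ φ ∈ F.Hom (extControl e) ⊤,
      ∀ x : P, (φ (Subgroup.inclusion (le_extControl e) x) : S) = e x

def IsSaturated (p : ℕ) (F : FusionSystem S) : Prop :=
  ∀ P : Subgroup S, ∃ Q : Subgroup S,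
    F.IsConj P Q ∧ F.IsFullyAutomized p Q ∧ F.IsReceptive Q

def IsEssential (p : ℕ) (F : FusionSystem S) (P : Subgroup S) : Prop :=
  P < ⊤ ∧ F.IsCentric P ∧ F.IsFullyNormalized P ∧
    ∃ M : Subgroup (F.Out P), IsStronglyPEmbedded p M

/-- `H_F(P)`: generated by the `F`-automorphisms of `P` which extend to `F`-isomorphisms between
strictly larger subgroups of `S`. -/
def extAut (F : FusionSystem S) (P : Subgroup S) : Subgroup (MulAut P) :=
  Subgroup.closure {α | α ∈ F.Aut P ∧
    ∃ (R R' : Subgroup S) (hR : P < R) (_ : P < R') (e : R ≃* R'),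
      e.toMonoidHom ∈ F.Hom R R' ∧
        ∀ x : P, (e (Subgroup.inclusion hR.le x) : S) = α x}

/-- `C` is a set of representatives of the `F`-conjugacy classes of `F`-essential subgroups. -/
def IsEssentialReps (p : ℕ) (F : FusionSystem S) (C : Set (Subgroup S)) : Prop :=
  (∀ E ∈ C, F.IsEssential p E) ∧
    ∀ E : Subgroup S, F.IsEssential p E → ∃! E' : Subgroup S, E' ∈ C ∧ F.IsConj E E'

/-- `⟨Aut_F(S), K, Aut_F(E) ∣ E ∈ C \ {P}⟩`. -/
def prune (F : FusionSystem S) (C : Set (Subgroup S)) (P : Subgroup S)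
    (K : Subgroup (MulAut P)) : FusionSystem S :=
  generate (Sigma.mk ⊤ '' (F.Aut ⊤ : Set (MulAut (⊤ : Subgroup S))) ∪
    Sigma.mk P '' (K : Set (MulAut P)) ∪
    ⋃ E ∈ C \ {P}, Sigma.mk E '' (F.Aut E : Set (MulAut E)))

end FusionSystem

/-! Write G for the pruned system and H for `F.extAut P`.

F and G have the same isomorphisms on F-centric subgroups that are not F-conjugate to P
(`prune_iso`). This is Alperin's argument by downward induction on order. An F-isomorphism X → Y
factors through an automorphism of a fully normalized conjugate E. The outer factors extend to
normalizers, which are larger, and Aut_F(E) is either among the generators of G or, when E is not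
essential, generated by automorphisms that extend to larger subgroups. The hypothesis on proper
subgroups of P ensures that an overgroup of X is never conjugate to P, so the induction does not run
into the class where morphisms were removed. On that class, transporting isomorphisms to P along
maps defined on normalizers turns every generator into an element of K, whence Aut_G(P) = K
(`aut_prune`).

Saturation of G at F-centric classes is inherited from F. At any other class every G-isomorphism is
a composite of isomorphisms that extend, since the generators are automorphisms of F-centric
subgroups. For such a class containing a subgroup that is not S-centric, saturation follows from
saturation at all larger orders (`isSaturatedAt_of_generatedAbove`), a form of the principle that
saturation can be tested on centric subgroups. The required member exists by
`isCentric_of_isCentric_prune`.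

For essentiality, P is receptive in F, so an automorphism fusing non-inner elements of Aut_S(P)
extends and lies in H. Hence, if K > H, the image of H in K/Inn(P) is strongly p-embedded.
Conversely, each generator of H does fuse such elements, so for K = H a strongly p-embedded subgroup
would have to be the whole group. -/

section GroupTheory

/-! ### Sylow subgroups and strongly p-embedded subgroups of finite groups -/

variable {Γ : Type*} [Group Γ] {p : ℕ}

/-- `T` is a `p`-subgroup of `B` of largest order. -/
def IsSylowIn (p : ℕ) (T B : Subgroup Γ) : Prop :=
  T ≤ B ∧ IsPGroup p T ∧ ∀ D ≤ B, IsPGroup p D → Nat.card D ≤ Nat.card T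

theorem Subgroup.card_map_conj (a : Γ) (D : Subgroup Γ) :
    Nat.card (D.map (MulAut.conj a).toMonoidHom) = Nat.card D :=
  Subgroup.card_map_of_injective (MulAut.conj a).injective

theorem IsSylowIn.mono {T B B' : Subgroup Γ} (h : IsSylowIn p T B) (hT : T ≤ B') (hB : B' ≤ B) :
    IsSylowIn p T B' :=
  ⟨hT, h.2.1, fun D hD => h.2.2 D (hD.trans hB)⟩

theorem Subgroup.isPGroup_subgroupOf {D B : Subgroup Γ} (hD : IsPGroup p D) :
    IsPGroup p (D.subgroupOf B) :=
  hD.comap_of_injective B.subtype B.subtype_injective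

theorem IsSylowIn.subgroupOf {T B : Subgroup Γ} (h : IsSylowIn p T B) :
    IsSylowIn p (T.subgroupOf B) ⊤ := by
  refine ⟨le_top, Subgroup.isPGroup_subgroupOf h.2.1, fun D _ hp => ?_⟩
  have h1 := h.2.2 (D.map B.subtype) (Subgroup.map_subtype_le D) (hp.map _)
  rw [Subgroup.card_map_of_injective B.subtype_injective] at h1
  rwa [Nat.card_congr (Subgroup.subgroupOfEquivOfLe h.1).toEquiv]

theorem isPGroup_zpowers_of_pow_eq_one {x : Γ} {k : ℕ} (h : x ^ p ^ k = 1) :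
    IsPGroup p (Subgroup.zpowers x) := by
  rintro ⟨_, n, rfl⟩
  refine ⟨k, Subtype.ext ?_⟩
  change (x ^ n) ^ p ^ k = 1
  rw [← zpow_natCast, zpow_comm, zpow_natCast, h, one_zpow]

variable [Finite Γ]

theorem IsSylowIn.exists_sylow {T B : Subgroup Γ} (h : IsSylowIn p T B) :
    ∃ T' : Sylow p B, (T' : Subgroup B).map B.subtype = T := by
  have hmap : (T.subgroupOf B).map B.subtype = T := by
    rw [Subgroup.subgroupOf_map_subtype, inf_eq_left.2 h.1]
  refine ⟨⟨T.subgroupOf B, Subgroup.isPGroup_subgroupOf h.2.1, fun {Q} hQ hle => ?_⟩, hmap⟩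
  have h1 := h.2.2 (Q.map B.subtype) (Subgroup.map_subtype_le Q) (hQ.map _)
  rw [← hmap, Subgroup.card_map_of_injective B.subtype_injective,
    Subgroup.card_map_of_injective B.subtype_injective] at h1
  exact (Subgroup.eq_of_le_of_card_ge hle h1).symm

theorem IsSylowIn.exists_conj [Fact p.Prime] {T B D : Subgroup Γ} (h : IsSylowIn p T B)
    (hD : D ≤ B) (hpD : IsPGroup p D) : ∃ b ∈ B, ∀ d ∈ D, b * d * b⁻¹ ∈ T := by
  obtain ⟨T', rfl⟩ := h.exists_sylow
  obtain ⟨Q, hQ⟩ := (Subgroup.isPGroup_subgroupOf (B := B) hpD).exists_le_sylow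
  obtain ⟨b, rfl⟩ := MulAction.exists_smul_eq B Q T'
  refine ⟨b, b.2, fun d hd => ⟨b * ⟨d, hD hd⟩ * b⁻¹, ?_, rfl⟩⟩
  exact Subgroup.smul_mem_pointwise_smul _ (MulAut.conj b) _ (hQ (show (⟨d, hD hd⟩ : B) ∈ _ from hd))

theorem isSylowIn_of_sylow [Fact p.Prime] {B : Subgroup Γ} (T : Sylow p B) :
    IsSylowIn p ((T : Subgroup B).map B.subtype) B := by
  refine ⟨Subgroup.map_subtype_le _, T.isPGroup'.map _, fun D hD hp => ?_⟩
  obtain ⟨Q, hQ⟩ := (Subgroup.isPGroup_subgroupOf (B := B) hp).exists_le_sylow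
  rw [Subgroup.card_map_of_injective B.subtype_injective, ← Nat.card_congr (Q.equiv T).toEquiv]
  calc Nat.card D = Nat.card (D.subgroupOf B) :=
        (Nat.card_congr (Subgroup.subgroupOfEquivOfLe hD).toEquiv).symm
    _ ≤ _ := Subgroup.card_le_of_le hQ

theorem exists_isSylowIn (p : ℕ) [Fact p.Prime] (B : Subgroup Γ) : ∃ T, IsSylowIn p T B :=
  ⟨_, isSylowIn_of_sylow (default : Sylow p B)⟩

/-- Conjugate a Sylow subgroup of B into T. This is used with B the stabilizer of a subgroup, to
place that subgroup well with respect to Aut_S. -/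
theorem IsSylowIn.exists_conj_inf [Fact p.Prime] {T A B : Subgroup Γ} (h : IsSylowIn p T A)
    (hB : B ≤ A) : ∃ a ∈ A, IsSylowIn p (T ⊓ B.map (MulAut.conj a).toMonoidHom)
      (B.map (MulAut.conj a).toMonoidHom) := by
  obtain ⟨D₀, hD₀⟩ := exists_isSylowIn p B
  obtain ⟨a, ha, hconj⟩ := h.exists_conj (hD₀.1.trans hB) hD₀.2.1
  refine ⟨a, ha, inf_le_right, h.2.1.to_le inf_le_left, fun D hD hp => ?_⟩
  have h1 : Nat.card (D.map (MulAut.conj a⁻¹).toMonoidHom) ≤ Nat.card D₀ := by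
    refine hD₀.2.2 _ ?_ (hp.map _)
    rintro _ ⟨d, hd, rfl⟩
    obtain ⟨b, hb, rfl⟩ := hD hd
    simpa [mul_assoc] using hb
  have h2 : D₀.map (MulAut.conj a).toMonoidHom ≤ T ⊓ B.map (MulAut.conj a).toMonoidHom := by
    refine le_inf ?_ (Subgroup.map_mono hD₀.1)
    rintro _ ⟨d, hd, rfl⟩
    exact hconj d hd
  rw [Subgroup.card_map_conj] at h1
  exact (h1.trans (Subgroup.card_map_conj a D₀).ge).trans (Subgroup.card_le_of_le h2)

/-- In a finite `p`-group normalizers grow. -/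
theorem IsPGroup.lt_inf_normalizer [Fact p.Prime] (hΓ : IsPGroup p Γ) {R M : Subgroup Γ}
    (h : R < M) : R < M ⊓ Subgroup.normalizer (R : Set Γ) := by
  refine lt_of_le_of_ne (le_inf h.le Subgroup.le_normalizer) fun heq => ?_
  have hM : IsPGroup p M := hΓ.to_subgroup M
  have := hM.isNilpotent
  have h1 : R.subgroupOf M < ⊤ := by
    rw [lt_top_iff_ne_top, Ne, Subgroup.subgroupOf_eq_top]
    exact not_le_of_gt h
  obtain ⟨x, hx, hxR⟩ := SetLike.exists_of_lt (Group.normalizerCondition_of_isNilpotent _ h1)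
  refine hxR ?_
  rw [Subgroup.mem_subgroupOf, heq]
  refine ⟨x.2, Subgroup.mem_normalizer_iff.2 fun g => ?_⟩
  rw [Subgroup.mem_normalizer_iff] at hx
  constructor
  · intro hg
    exact (hx ⟨g, h.le hg⟩).1 hg
  · intro hg
    have hgM : g ∈ M := by
      have := M.mul_mem (M.mul_mem (M.inv_mem x.2) (h.le hg)) x.2
      simpa [mul_assoc] using this
    exact (hx ⟨g, hgM⟩).2 hg

/-- Cauchy's theorem gives an element of order p in the quotient. Since N is a p-group, any lift of
it has p-power order. -/
theorem dvd_card_quotient_subgroup_iff [Fact p.Prime] {N : Subgroup Γ} [N.Normal]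
    (hN : IsPGroup p N) (L : Subgroup (Γ ⧸ N)) :
    p ∣ Nat.card L ↔ ∃ x : Γ, (x : Γ ⧸ N) ∈ L ∧ x ∉ N ∧ ∃ k : ℕ, x ^ p ^ k = 1 := by
  constructor
  · intro h
    obtain ⟨⟨y, hy⟩, hord⟩ := exists_prime_orderOf_dvd_card' p h
    obtain ⟨x, rfl⟩ := QuotientGroup.mk_surjective y
    have hpow : x ^ p ∈ N := by
      rw [← QuotientGroup.eq_one_iff, QuotientGroup.mk_pow]
      have := pow_orderOf_eq_one (⟨(x : Γ ⧸ N), hy⟩ : L)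
      rw [hord] at this
      exact congrArg Subtype.val this
    obtain ⟨k, hk⟩ := hN ⟨x ^ p, hpow⟩
    refine ⟨x, hy, fun hx => ?_, k + 1, ?_⟩
    · have h1 : (⟨(x : Γ ⧸ N), hy⟩ : L) = 1 :=
        Subtype.ext ((QuotientGroup.eq_one_iff x).2 hx)
      rw [h1, orderOf_one] at hord
      exact (Fact.out : p.Prime).one_lt.ne hord
    · rw [pow_succ', pow_mul]
      exact congrArg Subtype.val hk
  · rintro ⟨x, hx, hxN, k, hk⟩
    have h1 : orderOf (⟨(x : Γ ⧸ N), hx⟩ : L) ∣ p ^ k := by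
      apply orderOf_dvd_of_pow_eq_one
      apply Subtype.ext
      change (x : Γ ⧸ N) ^ p ^ k = 1
      rw [← QuotientGroup.mk_pow, hk, QuotientGroup.mk_one]
    obtain ⟨j, -, hj⟩ := (Nat.dvd_prime_pow Fact.out).1 h1
    have hj0 : j ≠ 0 := by
      rintro rfl
      rw [pow_zero, orderOf_eq_one_iff] at hj
      exact hxN ((QuotientGroup.eq_one_iff x).1 (congrArg Subtype.val hj))
    exact ((dvd_pow_self p hj0).trans hj.symm.dvd).trans (orderOf_dvd_natCard _)

/-- Moves the definition from Γ ⧸ N to elements of p-power order in Γ, where Aut_S(P) and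
conjugation can be handled without passing to Out. -/
theorem isStronglyPEmbedded_quotient_iff [Fact p.Prime] {N : Subgroup Γ} [N.Normal]
    (hN : IsPGroup p N) (M : Subgroup (Γ ⧸ N)) :
    IsStronglyPEmbedded p M ↔ M < ⊤ ∧
      (∃ x : Γ, (x : Γ ⧸ N) ∈ M ∧ x ∉ N ∧ ∃ k : ℕ, x ^ p ^ k = 1) ∧
      ∀ g x : Γ, (g : Γ ⧸ N) ∉ M → (∃ k : ℕ, x ^ p ^ k = 1) → (x : Γ ⧸ N) ∈ M →
        ((g⁻¹ * x * g : Γ) : Γ ⧸ N) ∈ M → x ∈ N := by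
  unfold IsStronglyPEmbedded
  rw [dvd_card_quotient_subgroup_iff hN]
  refine and_congr_right fun _ => and_congr_right fun _ => ?_
  have key : ∀ g x : Γ, (x : Γ ⧸ N) ∈ M ⊓ M.map (MulAut.conj (g : Γ ⧸ N)).toMonoidHom ↔
      (x : Γ ⧸ N) ∈ M ∧ ((g⁻¹ * x * g : Γ) : Γ ⧸ N) ∈ M := by
    intro g x
    rw [Subgroup.mem_inf]
    refine and_congr_right fun _ => ⟨?_, fun h => ⟨_, h, ?_⟩⟩
    · rintro ⟨y, hy, hyx⟩
      have : ((g⁻¹ * x * g : Γ) : Γ ⧸ N) = y := by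
        rw [QuotientGroup.mk_mul, QuotientGroup.mk_mul, ← hyx]
        simp [mul_assoc]
      rwa [this]
    · simp [mul_assoc]
  constructor
  · intro h g x hg hx h1 h2
    by_contra hxN
    refine h g hg ((dvd_card_quotient_subgroup_iff hN _).2 ⟨x, (key g x).2 ⟨h1, h2⟩, hxN, hx⟩)
  · intro h g hg hdvd
    obtain ⟨g, rfl⟩ := QuotientGroup.mk_surjective g
    obtain ⟨x, hxM, hxN, hx⟩ := (dvd_card_quotient_subgroup_iff hN _).1 hdvd
    obtain ⟨h1, h2⟩ := (key g x).1 hxM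
    exact hxN (h g x hg hx h1 h2)

/-- A proper subgroup containing a Sylow subgroup `T` and everything that fuses elements of
`T` outside of the normal `p`-subgroup `N` is strongly `p`-embedded modulo `N`. -/
theorem isStronglyPEmbedded_of_controls [Fact p.Prime] {N : Subgroup Γ} [N.Normal]
    (hN : IsPGroup p N) {T H : Subgroup Γ} (hT : IsSylowIn p T ⊤) (hTH : T ≤ H) (hNH : N ≤ H)
    (hNT : ∃ x ∈ T, x ∉ N) (hH : H ≠ ⊤)
    (hfus : ∀ β x : Γ, x ∈ T → x ∉ N → β * x * β⁻¹ ∈ T → β ∈ H) :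
    IsStronglyPEmbedded p (H.map (QuotientGroup.mk' N)) := by
  have hmem : ∀ x : Γ, (x : Γ ⧸ N) ∈ H.map (QuotientGroup.mk' N) ↔ x ∈ H := by
    intro x
    constructor
    · rintro ⟨y, hy, hyx⟩
      have h1 : y⁻¹ * x ∈ N := QuotientGroup.eq.1 hyx
      simpa using H.mul_mem hy (hNH h1)
    · exact fun hx => ⟨x, hx, rfl⟩
  have hconj : ∀ x ∈ H, (∃ k : ℕ, x ^ p ^ k = 1) → ∃ h ∈ H, h * x * h⁻¹ ∈ T := by
    rintro x hx ⟨k, hk⟩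
    obtain ⟨h, hh, hc⟩ := (hT.mono hTH le_top).exists_conj (D := Subgroup.zpowers x)
      (by simpa using hx) (isPGroup_zpowers_of_pow_eq_one hk)
    exact ⟨h, hh, hc x (Subgroup.mem_zpowers x)⟩
  rw [isStronglyPEmbedded_quotient_iff hN]
  refine ⟨lt_top_iff_ne_top.2 fun h => hH ?_, ?_, ?_⟩
  · rw [Subgroup.eq_top_iff']
    intro x
    rw [← hmem x, h]
    trivial
  · obtain ⟨x, hxT, hxN⟩ := hNT
    obtain ⟨k, hk⟩ := hT.2.1 ⟨x, hxT⟩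
    exact ⟨x, (hmem x).2 (hTH hxT), hxN, k, congrArg Subtype.val hk⟩
  · intro g x hg hx h1 h2
    rw [hmem] at hg h1 h2
    by_contra hxN
    obtain ⟨a, ha, hax⟩ := hconj x h1 hx
    obtain ⟨b, hb, hbx⟩ := hconj _ h2 (by
      obtain ⟨k, hk⟩ := hx
      refine ⟨k, ?_⟩
      have := conj_pow (i := p ^ k) (a := g⁻¹) (b := x)
      rw [inv_inv] at this
      rw [this, hk, mul_one, inv_mul_cancel])
    have h3 : b * g⁻¹ * a⁻¹ ∈ H := by
      refine hfus _ (a * x * a⁻¹) hax (fun h => hxN ?_) ?_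
      · have := ‹N.Normal›.conj_mem _ h a⁻¹
        simpa [mul_assoc] using this
      · simpa [mul_assoc] using hbx
    apply hg
    have h4 : g⁻¹ ∈ H := by
      simpa [mul_assoc] using H.mul_mem (H.mul_mem (H.inv_mem hb) h3) ha
    simpa using h4

/-- If `Γ` is generated by elements that fuse elements of a Sylow subgroup `T` outside of the
normal `p`-subgroup `N`, then `Γ ⧸ N` has no strongly `p`-embedded subgroup. -/
theorem not_isStronglyPEmbedded_of_closure_eq_top [Fact p.Prime] {N : Subgroup Γ} [N.Normal]
    (hN : IsPGroup p N) {T : Subgroup Γ} (hT : IsSylowIn p T ⊤) {s : Set Γ}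
    (hs : Subgroup.closure s = ⊤)
    (hfus : ∀ β ∈ s, ∃ x ∈ T, x ∉ N ∧ β * x * β⁻¹ ∈ T) (M : Subgroup (Γ ⧸ N)) :
    ¬ IsStronglyPEmbedded p M := by
  rw [isStronglyPEmbedded_quotient_iff hN]
  rintro ⟨hM, ⟨x, hxM, hxN, k, hk⟩, hint⟩
  obtain ⟨c, -, hc⟩ := hT.exists_conj (D := Subgroup.zpowers x) le_top
    (isPGroup_zpowers_of_pow_eq_one hk)
  have hcx := hc x (Subgroup.mem_zpowers x)
  have hpT : ∀ t ∈ T, ∃ k : ℕ, t ^ p ^ k = 1 := fun t ht => by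
    obtain ⟨k, hk⟩ := hT.2.1 ⟨t, ht⟩
    exact ⟨k, congrArg Subtype.val hk⟩
  -- the conjugate of `M` that meets `T` outside of `N`
  let L : Subgroup Γ := (M.comap (QuotientGroup.mk' N)).map (MulAut.conj c).toMonoidHom
  have hL : ∀ y : Γ, y ∈ L ↔ ((c⁻¹ * y * c : Γ) : Γ ⧸ N) ∈ M := by
    intro y
    constructor
    · rintro ⟨z, hz, rfl⟩
      simpa [mul_assoc] using hz
    · intro h
      exact ⟨c⁻¹ * y * c, h, by simp [mul_assoc]⟩
  have hLint : ∀ g y : Γ, g ∉ L → y ∈ T → y ∈ L → g⁻¹ * y * g ∈ L → y ∈ N := by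
    intro g y hg hy h1 h2
    rw [hL] at hg h1 h2
    obtain ⟨k, hk⟩ := hpT y hy
    have h3 := hint _ _ hg ⟨k, ?_⟩ h1 (by simpa [mul_assoc] using h2)
    · simpa [mul_assoc] using ‹N.Normal›.conj_mem _ h3 c
    · have := conj_pow (i := p ^ k) (a := c⁻¹) (b := y)
      rw [inv_inv] at this
      rw [this, hk, mul_one, inv_mul_cancel]
  have hyL : c * x * c⁻¹ ∈ L := by
    rw [hL]
    simpa [mul_assoc] using hxM
  have hyN : c * x * c⁻¹ ∉ N := fun h => hxN (by
    simpa [mul_assoc] using ‹N.Normal›.conj_mem _ h c⁻¹)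
  -- If T were not in L, some element of T outside L would normalize L ∩ T, and the non-N element
  -- found in L ∩ T would lie in L together with its conjugate, against `hLint`.
  have hTL : T ≤ L := by
    by_contra hle
    have hlt : (L ⊓ T).subgroupOf T < ⊤ := by
      rw [lt_top_iff_ne_top, Ne, Subgroup.subgroupOf_eq_top]
      exact fun h => hle (h.trans inf_le_left)
    have := hT.2.1.isNilpotent
    obtain ⟨g, hg, hgL⟩ := SetLike.exists_of_lt (Group.normalizerCondition_of_isNilpotent _ hlt)
    have hgL' : (g : Γ) ∉ L := fun h => hgL ⟨h, g.2⟩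
    have h1 := (Subgroup.mem_normalizer_iff''.1 hg ⟨c * x * c⁻¹, hcx⟩).1
      (show _ ∈ L ⊓ T from ⟨hyL, hcx⟩)
    exact hyN (hLint g _ hgL' hcx hyL h1.1)
  have hsL : Subgroup.closure s ≤ L := by
    rw [Subgroup.closure_le]
    intro β hβ
    obtain ⟨t, ht, htN, htβ⟩ := hfus β hβ
    by_contra hβL
    refine htN (hLint β⁻¹ t (fun h => hβL ?_) ht (hTL ht) ?_)
    · simpa using h
    · simpa using hTL htβ
  refine hM.ne ((Subgroup.eq_top_iff' M).2 fun y => ?_)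
  obtain ⟨y, rfl⟩ := QuotientGroup.mk_surjective y
  have h1 : c * y * c⁻¹ ∈ L := hsL (by rw [hs]; trivial)
  rw [hL] at h1
  simpa [mul_assoc] using h1

end GroupTheory

/-! ### Isomorphisms of a fusion system as restrictions of permutations of S -/

namespace FusionSystem

theorem perm_apply_inv {S : Type*} (σ : Equiv.Perm S) (s : S) : σ (σ⁻¹ s) = s :=
  σ.apply_symm_apply s

theorem perm_inv_apply {S : Type*} (σ : Equiv.Perm S) (s : S) : σ⁻¹ (σ s) = s :=
  σ.symm_apply_apply s

variable {S : Type*} [Group S]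

local notation "N[" X "]" => Subgroup.normalizer (X : Set S)
local notation "C[" X "]" => Subgroup.centralizer (X : Set S)

/-- The permutation `σ` of `S` restricts to an isomorphism `X → Y` of `F`. -/
def Iso (F : FusionSystem S) (X Y : Subgroup S) (σ : Equiv.Perm S) : Prop :=
  ∃ e : X ≃* Y, e.toMonoidHom ∈ F.Hom X Y ∧ ∀ x : X, σ x = e x

namespace Iso

variable {F : FusionSystem S} {X Y Z X' Y' R R' : Subgroup S} {σ τ : Equiv.Perm S}

theorem mem_iff (h : F.Iso X Y σ) {s : S} : σ s ∈ Y ↔ s ∈ X := by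
  obtain ⟨e, -, he⟩ := h
  constructor
  · intro hs
    obtain ⟨x, hx⟩ := e.surjective ⟨σ s, hs⟩
    have h1 : σ x = σ s := by rw [he, hx]
    rw [← σ.injective h1]
    exact x.2
  · intro hs
    rw [he ⟨s, hs⟩]
    exact (e _).2

theorem map_mul (h : F.Iso X Y σ) {x y : S} (hx : x ∈ X) (hy : y ∈ X) :
    σ (x * y) = σ x * σ y := by
  obtain ⟨e, -, he⟩ := h
  have := congrArg Subtype.val (_root_.map_mul e ⟨x, hx⟩ ⟨y, hy⟩)
  rw [← he] at this
  simpa [← he] using this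

theorem map_one (h : F.Iso X Y σ) : σ 1 = 1 := by
  have := h.map_mul X.one_mem X.one_mem
  simpa using this

theorem map_inv (h : F.Iso X Y σ) {x : S} (hx : x ∈ X) : σ x⁻¹ = (σ x)⁻¹ := by
  rw [eq_inv_iff_mul_eq_one, ← h.map_mul (X.inv_mem hx) hx, inv_mul_cancel, h.map_one]

theorem map_conj (h : F.Iso X Y σ) {x y : S} (hx : x ∈ X) (hy : y ∈ X) :
    σ (x * y * x⁻¹) = σ x * σ y * (σ x)⁻¹ := by
  rw [h.map_mul (X.mul_mem hx hy) (X.inv_mem hx), h.map_mul hx hy, h.map_inv hx]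

theorem congr (h : F.Iso X Y σ) (hτ : ∀ x ∈ X, τ x = σ x) : F.Iso X Y τ := by
  obtain ⟨e, he, h1⟩ := h
  exact ⟨e, he, fun x => (hτ x x.2).trans (h1 x)⟩

theorem trans (h : F.Iso X Y σ) (h' : F.Iso Y Z τ) : F.Iso X Z (τ * σ) := by
  obtain ⟨e, he, h1⟩ := h
  obtain ⟨e', he', h1'⟩ := h'
  refine ⟨e.trans e', F.comp_mem he he', fun x => ?_⟩
  rw [Equiv.Perm.mul_apply, h1, h1']
  rfl

theorem symm (h : F.Iso X Y σ) : F.Iso Y X σ⁻¹ := by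
  obtain ⟨e, he, h1⟩ := h
  refine ⟨e.symm, F.symm_mem he, fun y => ?_⟩
  rw [Equiv.Perm.inv_eq_iff_eq, h1, MulEquiv.apply_symm_apply]

theorem right_unique (h : F.Iso X Y σ) (h' : F.Iso X Y' σ) : Y = Y' := by
  ext y
  rw [← σ.apply_symm_apply y, h.mem_iff, h'.mem_iff]

theorem card_eq (h : F.Iso X Y σ) : Nat.card X = Nat.card Y := by
  obtain ⟨e, -, -⟩ := h
  exact Nat.card_congr e.toEquiv

theorem isConj (h : F.Iso X Y σ) : F.IsConj X Y := by
  obtain ⟨e, he, -⟩ := h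
  exact ⟨e, he⟩

theorem of_hom {φ : X →* Y} (hφ : φ ∈ F.Hom X Y) (hσ : ∀ s, σ s ∈ Y ↔ s ∈ X)
    (h : ∀ x : X, σ x = φ x) : F.Iso X Y σ := by
  have hs : Function.Surjective φ := fun y => by
    have hx : σ⁻¹ (y : S) ∈ X := by
      rw [← hσ]
      simp
    exact ⟨⟨_, hx⟩, Subtype.ext (by rw [← h]; simp)⟩
  exact ⟨MulEquiv.ofBijective φ ⟨F.injective hφ, hs⟩, hφ, h⟩

theorem conj (F : FusionSystem S) (g : S) (h : ∀ s, g * s * g⁻¹ ∈ Y ↔ s ∈ X) :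
    F.Iso X Y (MulAut.conj g).toEquiv := by
  let φ : X →* Y :=
    { toFun := fun x => ⟨g * x * g⁻¹, (h x).2 x.2⟩
      map_one' := by ext; simp
      map_mul' := fun x y => by ext; simp }
  exact of_hom (φ := φ) (F.conj_mem φ g⁻¹ fun x => by simp [φ]) h fun x => rfl

theorem refl (F : FusionSystem S) (X : Subgroup S) : F.Iso X X 1 :=
  (conj F 1 (by simp)).congr (by simp)

theorem restrict (h : F.Iso R R' σ) (hX : X ≤ R) (hXY : ∀ s, σ s ∈ Y ↔ s ∈ X) :
    F.Iso X Y σ := by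
  obtain ⟨e, he, h1⟩ := h
  have hi : Subgroup.inclusion hX ∈ F.Hom X R := F.conj_mem _ 1 fun x => by simp
  obtain ⟨W, hW, f, hf, -, hf'⟩ := F.factor (F.comp_mem hi he)
  have h2 : ∀ x : X, σ x = f x := fun x => by
    have := congrArg Subtype.val (DFunLike.congr_fun hf' x)
    simp only [MonoidHom.comp_apply] at this
    exact (h1 ⟨x, hX x.2⟩).trans this
  have hWY : W = Y := by
    have h3 : F.Iso X W σ := ⟨f, hf, h2⟩
    ext y
    rw [← σ.apply_symm_apply y, h3.mem_iff, hXY]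
  subst hWY
  exact ⟨f, hf, h2⟩

theorem exists_restrict (h : F.Iso R R' σ) (hX : X ≤ R) : ∃ Y ≤ R', F.Iso X Y σ := by
  let Y : Subgroup S :=
    { carrier := σ '' X
      one_mem' := ⟨1, X.one_mem, h.map_one⟩
      mul_mem' := by
        rintro _ _ ⟨x, hx, rfl⟩ ⟨y, hy, rfl⟩
        exact ⟨x * y, X.mul_mem hx hy, h.map_mul (hX hx) (hX hy)⟩
      inv_mem' := by
        rintro _ ⟨x, hx, rfl⟩
        exact ⟨x⁻¹, X.inv_mem hx, h.map_inv (hX hx)⟩ }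
  refine ⟨Y, ?_, h.restrict hX fun s => σ.injective.mem_set_image⟩
  rintro _ ⟨x, hx, rfl⟩
  exact h.mem_iff.2 (hX hx)

theorem le_of_le (h : F.Iso X Y σ) (h' : F.Iso R R' σ) (hX : X ≤ R) : Y ≤ R' := by
  obtain ⟨Y', hY', h1⟩ := h'.exists_restrict hX
  rwa [h.right_unique h1]

theorem lt_of_lt (h : F.Iso X Y σ) (h' : F.Iso R R' σ) (hX : X < R) : Y < R' := by
  refine lt_of_le_of_ne (h.le_of_le h' hX.le) ?_
  rintro rfl
  exact hX.ne (h.symm.right_unique h'.symm)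

theorem mem_normalizer_iff (h : F.Iso R R' σ) (hX : X ≤ R) (h' : F.Iso X Y σ) {s : S}
    (hs : s ∈ R) : σ s ∈ N[Y] ↔ s ∈ N[X] := by
  have hY := h'.le_of_le h hX
  have key : ∀ {F : FusionSystem S} {X Y R R' : Subgroup S} {σ : Equiv.Perm S}, F.Iso R R' σ →
      X ≤ R → F.Iso X Y σ → ∀ {s : S}, s ∈ R → s ∈ N[X] → σ s ∈ N[Y] := by
    intro F X Y R R' σ h hX h' s hs hsX
    have hsub : ∀ t ∈ R, t ∈ N[X] → ∀ y ∈ Y, σ t * y * (σ t)⁻¹ ∈ Y := by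
      intro t ht htX y hy
      have hx : σ⁻¹ y ∈ X := h'.symm.mem_iff.2 hy
      have h1 := h.map_conj ht (hX hx)
      rw [perm_apply_inv] at h1
      rw [← h1, h'.mem_iff]
      exact (Subgroup.mem_normalizer_iff.1 htX _).1 hx
    refine Subgroup.mem_normalizer_iff.2 fun y => ⟨hsub s hs hsX y, fun hy => ?_⟩
    have h2 := hsub s⁻¹ (R.inv_mem hs) (Subgroup.inv_mem _ hsX) _ hy
    rw [h.map_inv hs] at h2
    simpa [mul_assoc] using h2
  refine ⟨fun hsY => ?_, key h hX h' hs⟩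
  simpa using key h.symm hY h'.symm (h.mem_iff.2 hs) hsY

theorem mem_centralizer_iff (h : F.Iso R R' σ) (hX : X ≤ R) (h' : F.Iso X Y σ) {s : S}
    (hs : s ∈ R) : σ s ∈ C[Y] ↔ s ∈ C[X] := by
  simp only [Subgroup.mem_centralizer_iff]
  constructor
  · intro hc x hx
    have := hc (σ x) (h'.mem_iff.2 hx)
    rw [← h.map_mul (hX hx) hs, ← h.map_mul hs (hX hx)] at this
    exact σ.injective this
  · intro hc y hy
    have hx : σ⁻¹ y ∈ X := h'.symm.mem_iff.2 hy
    have := congrArg σ (hc _ hx)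
    rwa [h.map_mul (hX hx) hs, h.map_mul hs (hX hx), perm_apply_inv] at this

theorem le_normalizer (h : F.Iso R R' σ) (h' : F.Iso X Y σ) (hX : X ≤ R) (hR : R ≤ N[X]) :
    R' ≤ N[Y] := by
  intro y hy
  have hr : σ⁻¹ y ∈ R := h.symm.mem_iff.2 hy
  simpa using (h.mem_normalizer_iff hX h' hr).2 (hR hr)

end Iso

/-- Since S is finite, a bijection between two subsets extends to a permutation. Representing
morphisms by permutations lets them be composed, inverted and restricted without changing type. -/
theorem exists_iso_of_hom [Finite S] {F : FusionSystem S} {X Y : Subgroup S} {φ : X →* Y}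
    (hφ : φ ∈ F.Hom X Y) : ∃ (σ : Equiv.Perm S) (W : Subgroup S), W ≤ Y ∧ F.Iso X W σ ∧
      ∀ x : X, σ x = φ x := by
  classical
  have := Fintype.ofFinite S
  obtain ⟨W, hW, f, hf, -, rfl⟩ := F.factor hφ
  have h1 : ∀ x : X, (f.toEquiv.extendSubtype : Equiv.Perm S) x = f x := fun x =>
    f.toEquiv.extendSubtype_apply_of_mem x x.2
  exact ⟨f.toEquiv.extendSubtype, W, hW, ⟨f, hf, h1⟩, h1⟩

theorem isConj_iff_exists_iso [Finite S] {F : FusionSystem S} {X Y : Subgroup S} :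
    F.IsConj X Y ↔ ∃ σ, F.Iso X Y σ := by
  constructor
  · rintro ⟨e, he⟩
    classical
    have := Fintype.ofFinite S
    exact ⟨e.toEquiv.extendSubtype, e, he, fun x => e.toEquiv.extendSubtype_apply_of_mem x x.2⟩
  · rintro ⟨σ, h⟩
    exact h.isConj

/-- The permutation of `S` that is `α` on `X` and the identity elsewhere. -/
noncomputable def extendAut {X : Subgroup S} (α : MulAut X) : Equiv.Perm S :=
  open Classical in Equiv.Perm.ofSubtype (p := (· ∈ X)) α.toEquiv

theorem extendAut_apply {X : Subgroup S} (α : MulAut X) (x : X) : extendAut α x = α x := by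
  classical
  exact Equiv.Perm.ofSubtype_apply_coe (p := (· ∈ X)) α.toEquiv x

theorem iso_extendAut_iff {F : FusionSystem S} {X : Subgroup S} {α : MulAut X} :
    F.Iso X X (extendAut α) ↔ α ∈ F.Aut X := by
  constructor
  · rintro ⟨e, he, h⟩
    have : α = e := MulEquiv.ext fun x => Subtype.ext ((extendAut_apply α x).symm.trans (h x))
    rw [this]
    exact he
  · exact fun h => ⟨α, h, extendAut_apply α⟩

theorem Iso.exists_aut {F : FusionSystem S} {X : Subgroup S} {σ : Equiv.Perm S}
    (h : F.Iso X X σ) : ∃ α ∈ F.Aut X, ∀ x : X, σ x = α x := by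
  obtain ⟨e, he, h⟩ := h
  exact ⟨e, he, h⟩

theorem iso_of_mem_aut {F : FusionSystem S} {X : Subgroup S} {α : MulAut X} (hα : α ∈ F.Aut X)
    {σ : Equiv.Perm S} (h : ∀ x : X, σ x = α x) : F.Iso X X σ :=
  ⟨α, hα, h⟩

/-- `F`-conjugacy of subgroups along a morphism defined on the normalizer. -/
def To (F : FusionSystem S) (X Y : Subgroup S) : Prop :=
  ∃ (σ : Equiv.Perm S) (W : Subgroup S), F.Iso X Y σ ∧ W ≤ N[Y] ∧ F.Iso N[X] W σ

theorem To.refl (F : FusionSystem S) (X : Subgroup S) : F.To X X :=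
  ⟨1, _, Iso.refl F X, le_rfl, Iso.refl F _⟩

theorem To.of_le {F : FusionSystem S} {X Y V W : Subgroup S} {σ : Equiv.Perm S}
    (h : F.Iso X Y σ) (h' : F.Iso V W σ) (hV : N[X] ≤ V) : F.To X Y := by
  obtain ⟨W', -, h1⟩ := h'.exists_restrict hV
  exact ⟨σ, W', h, h1.le_normalizer h Subgroup.le_normalizer le_rfl, h1⟩

theorem To.trans {F : FusionSystem S} {X Y Z : Subgroup S} (h : F.To X Y) (h' : F.To Y Z) :
    F.To X Z := by
  obtain ⟨σ, W, h1, h2, h3⟩ := h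
  obtain ⟨τ, V, h4, h5, h6⟩ := h'
  obtain ⟨V', h7, h8⟩ := h6.exists_restrict h2
  exact ⟨τ * σ, V', h1.trans h4, h7.trans h5, h3.trans h8⟩

theorem To.isConj {F : FusionSystem S} {X Y : Subgroup S} (h : F.To X Y) : F.IsConj X Y := by
  obtain ⟨σ, W, h1, -, -⟩ := h
  exact h1.isConj

/-- If normalizers have the same order, an arrow is an isomorphism of normalizers. -/
theorem To.exists_iso_normalizer [Finite S] {F : FusionSystem S} {X Y : Subgroup S} (h : F.To X Y)
    (hc : Nat.card N[Y] ≤ Nat.card N[X]) : ∃ σ, F.Iso X Y σ ∧ F.Iso N[X] N[Y] σ := by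
  obtain ⟨σ, W, h1, h2, h3⟩ := h
  rw [h3.card_eq] at hc
  have := Subgroup.eq_of_le_of_card_ge h2 hc
  subst this
  exact ⟨σ, h1, h3⟩

theorem To.symm_of_card [Finite S] {F : FusionSystem S} {X Y : Subgroup S} (h : F.To X Y)
    (hc : Nat.card N[Y] ≤ Nat.card N[X]) : F.To Y X := by
  obtain ⟨σ, h1, h2⟩ := h.exists_iso_normalizer hc
  exact ⟨σ⁻¹, _, h1.symm, le_rfl, h2.symm⟩

end FusionSystem

/-! ### Receptive subgroups and extension of isomorphisms -/

namespace FusionSystem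

variable {S : Type*} [Group S]

local notation "N[" X "]" => Subgroup.normalizer (X : Set S)

theorem mem_autS_iff {Z : Subgroup S} {α : MulAut Z} :
    α ∈ autS Z ↔ ∃ g ∈ N[Z], ∀ z : Z, (α z : S) = g * z * g⁻¹ := by
  constructor
  · rintro ⟨g, rfl⟩
    exact ⟨g, g.2, fun z => rfl⟩
  · rintro ⟨g, hg, h⟩
    exact ⟨⟨g, hg⟩, MulEquiv.ext fun z => Subtype.ext (h z).symm⟩

theorem isPGroup_autS {p : ℕ} (hS : IsPGroup p S) (Z : Subgroup S) : IsPGroup p (autS Z) :=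
  (hS.to_subgroup _).of_surjective _ Z.normalizerMonoidHom.rangeRestrict_surjective

theorem Iso.of_mem_normalizer (F : FusionSystem S) {Z : Subgroup S} {g : S} (hg : g ∈ N[Z]) :
    F.Iso Z Z (MulAut.conj g).toEquiv :=
  Iso.conj F g fun s => (Subgroup.mem_normalizer_iff.1 hg s).symm

theorem autS_le_aut (F : FusionSystem S) (Z : Subgroup S) : autS Z ≤ F.Aut Z := by
  intro α hα
  obtain ⟨g, hg, h⟩ := mem_autS_iff.1 hα
  rw [← iso_extendAut_iff]
  refine (Iso.of_mem_normalizer F hg).congr fun x hx => ?_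
  rw [extendAut_apply α ⟨x, hx⟩, h]
  rfl

theorem mem_extControl_iff {X Y : Subgroup S} {e : X ≃* Y} {σ : Equiv.Perm S}
    (hσ : ∀ x : X, σ x = e x) {g : S} :
    g ∈ extControl e ↔ g ∈ N[X] ∧
      ∃ h ∈ N[Y], ∀ x ∈ X, σ (g * x * g⁻¹) = h * σ x * h⁻¹ := by
  have key : ∀ (k : N[X]) (x : X),
      (MulAut.congr e (X.normalizerMonoidHom k) (e x) : S) = σ (k * x * (k : S)⁻¹) := by
    intro k x
    have h1 : MulAut.congr e (X.normalizerMonoidHom k) (e x) = e (X.normalizerMonoidHom k x) := by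
      simp [MulAut.congr]
    rw [h1, ← hσ]
    rfl
  constructor
  · rintro ⟨k, hk, rfl⟩
    obtain ⟨h, hh, h1⟩ := mem_autS_iff.1 hk
    refine ⟨k.2, h, hh, fun x hx => ?_⟩
    rw [hσ ⟨x, hx⟩, ← h1]
    exact (key k ⟨x, hx⟩).symm
  · rintro ⟨hg, h, hh, h1⟩
    refine ⟨⟨g, hg⟩, mem_autS_iff.2 ⟨h, hh, fun y => ?_⟩, rfl⟩
    obtain ⟨x, rfl⟩ := e.surjective y
    rw [← hσ, ← h1 x x.2]
    exact key ⟨g, hg⟩ x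

/-- Replaces the control group by an arbitrary subgroup D of it, so that a partial extension can be
requested without computing N_α. -/
theorem isReceptive_iff [Finite S] {F : FusionSystem S} {Z : Subgroup S} :
    F.IsReceptive Z ↔ ∀ (R : Subgroup S) (σ : Equiv.Perm S), F.Iso R Z σ → ∀ D ≤ N[R],
      (∀ d ∈ D, ∃ g ∈ N[Z], ∀ r ∈ R, σ (d * r * d⁻¹) = g * σ r * g⁻¹) →
      ∃ (τ : Equiv.Perm S) (V W : Subgroup S), R ≤ V ∧ D ≤ V ∧ F.Iso V W τ ∧
        ∀ r ∈ R, τ r = σ r := by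
  constructor
  · rintro h R σ ⟨e, he, hσ⟩ D hD hc
    obtain ⟨φ, hφ, h1⟩ := h R e he
    obtain ⟨τ, W, -, hτ, h2⟩ := exists_iso_of_hom hφ
    refine ⟨τ, _, W, le_extControl e, fun d hd => (mem_extControl_iff hσ).2 ⟨hD hd, hc d hd⟩,
      hτ, fun r hr => ?_⟩
    rw [hσ ⟨r, hr⟩, ← h1]
    exact h2 ⟨r, le_extControl e hr⟩
  · intro h R e he
    obtain ⟨σ, _, -, -, hσ⟩ := exists_iso_of_hom he
    replace hσ : ∀ x : R, σ x = e x := hσ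
    obtain ⟨τ, V, W, hRV, hDV, hτ, h1⟩ := h R σ ⟨e, he, hσ⟩ (extControl e)
      (fun d hd => ((mem_extControl_iff hσ).1 hd).1)
      (fun d hd => ((mem_extControl_iff hσ).1 hd).2)
    obtain ⟨f, hf, h2⟩ := hτ
    have hi : Subgroup.inclusion hDV ∈ F.Hom (extControl e) V := F.conj_mem _ 1 fun x => by simp
    have hj : Subgroup.inclusion (le_top : W ≤ ⊤) ∈ F.Hom W ⊤ := F.conj_mem _ 1 fun x => by simp
    refine ⟨_, F.comp_mem (F.comp_mem hi hf) hj, fun x => ?_⟩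
    rw [← hσ, ← h1 x x.2]
    exact (h2 ⟨x, hRV x.2⟩).symm

/-- The `F`-automorphisms of `Z` that stabilize `Y`. -/
def stabAut (F : FusionSystem S) (Z Y : Subgroup S) : Subgroup (MulAut Z) where
  carrier := {b | b ∈ F.Aut Z ∧ ∀ z : Z, (b z : S) ∈ Y ↔ (z : S) ∈ Y}
  one_mem' := ⟨one_mem _, fun z => Iff.rfl⟩
  mul_mem' := fun {a b} ha hb => ⟨mul_mem ha.1 hb.1, fun z => (ha.2 (b z)).trans (hb.2 z)⟩
  inv_mem' := fun {a} ha => ⟨inv_mem ha.1, fun z => by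
    rw [← ha.2 (a⁻¹ z), MulAut.apply_inv_self]⟩

theorem mem_stabAut_iff {F : FusionSystem S} {Z Y : Subgroup S} {b : MulAut Z} :
    b ∈ stabAut F Z Y ↔ b ∈ F.Aut Z ∧ ∀ z : Z, (b z : S) ∈ Y ↔ (z : S) ∈ Y :=
  Iff.rfl

theorem stabAut_self (F : FusionSystem S) (Z : Subgroup S) : stabAut F Z Z = F.Aut Z := by
  ext b
  rw [mem_stabAut_iff]
  exact and_iff_left fun z => by simp

/-- `Z` is receptive, and the part of `Aut_S(Z)` stabilizing `Y ≤ Z` is a Sylow `p`-subgroup of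
the stabilizer of `Y` in `Aut_F(Z)`. -/
def Good (p : ℕ) (F : FusionSystem S) (Z Y : Subgroup S) : Prop :=
  Y ≤ Z ∧ F.IsReceptive Z ∧ IsSylowIn p (autS Z ⊓ stabAut F Z Y) (stabAut F Z Y)

variable [Finite S] {F : FusionSystem S} {p : ℕ} {R X Z Y : Subgroup S} {σ : Equiv.Perm S}

instance finite_mulAut (Z : Subgroup S) : Finite (MulAut Z) :=
  Finite.of_injective (fun α : MulAut Z => (α : Z → Z)) DFunLike.coe_injective

theorem isFullyAutomized_iff [Fact p.Prime] :
    F.IsFullyAutomized p Z ↔ IsSylowIn p (autS Z) (F.Aut Z) := by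
  constructor
  · rintro ⟨T, hT⟩
    rw [← hT]
    exact isSylowIn_of_sylow T
  · exact fun h => h.exists_sylow

theorem good_self_iff [Fact p.Prime] :
    Good p F Z Z ↔ F.IsFullyAutomized p Z ∧ F.IsReceptive Z := by
  rw [Good, stabAut_self, inf_eq_left.2 (autS_le_aut F Z), isFullyAutomized_iff]
  tauto

/-- D acts on Z through a p-subgroup of B. Sylow's theorem in B conjugates this into Aut_S(Z), and
the conjugating b is the correction after which receptivity applies. -/
theorem IsReceptive.exists_extend [Fact p.Prime] (hS : IsPGroup p S) (hZ : F.IsReceptive Z)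
    {B : Subgroup (MulAut Z)} (hBF : B ≤ F.Aut Z) (hB : IsSylowIn p (autS Z ⊓ B) B)
    (hR : F.Iso R Z σ) {D : Subgroup S} (hDN : D ≤ N[R])
    (hD : ∀ d ∈ D, ∃ b ∈ B, ∀ r ∈ R, σ (d * r * d⁻¹) = extendAut b (σ r)) :
    ∃ b ∈ B, ∃ (τ : Equiv.Perm S) (V W : Subgroup S), R ≤ V ∧ D ≤ V ∧ F.Iso V W τ ∧
      ∀ r ∈ R, τ r = extendAut b (σ r) := by
  obtain ⟨e, he, hσ⟩ := id hR
  let f : N[R] →* MulAut Z := (MulAut.congr e).toMonoidHom.comp R.normalizerMonoidHom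
  have hf : ∀ (d : N[R]) (r : R), (f d (e r) : S) = σ (d * r * (d : S)⁻¹) := by
    intro d r
    have h1 : f d (e r) = e (R.normalizerMonoidHom d r) := by
      simp [f, MulAut.congr]
    rw [h1, ← hσ]
    rfl
  have hDB : (D.subgroupOf N[R]).map f ≤ B := by
    rintro _ ⟨d, hd, rfl⟩
    obtain ⟨b, hb, h1⟩ := hD d hd
    convert hb using 1
    refine MulEquiv.ext fun z => Subtype.ext ?_
    obtain ⟨r, rfl⟩ := e.surjective z
    rw [hf, h1 r r.2, hσ, extendAut_apply]
  obtain ⟨b, hb, hconj⟩ := hB.exists_conj hDB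
    ((Subgroup.isPGroup_subgroupOf (hS.to_subgroup D)).map f)
  have hiso : F.Iso R Z (extendAut b * σ) := hR.trans (iso_extendAut_iff.2 (hBF hb))
  obtain ⟨τ, V, W, h1, h2, h3, h4⟩ := isReceptive_iff.1 hZ R _ hiso D hDN fun d hd => by
    obtain ⟨g, hg, h5⟩ := mem_autS_iff.1 (hconj (f ⟨d, hDN hd⟩) ⟨⟨d, hDN hd⟩, hd, rfl⟩).1
    refine ⟨g, hg, fun r hr => ?_⟩
    have h6 := h5 (b (e ⟨r, hr⟩))
    simp only [MulAut.mul_apply, MulAut.inv_apply_self] at h6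
    rw [Equiv.Perm.mul_apply, Equiv.Perm.mul_apply, hσ ⟨r, hr⟩, extendAut_apply, ← h6,
      ← extendAut_apply, hf]
  exact ⟨b, hb, τ, V, W, h1, h2, h3, h4⟩

/-- The case B = stabilizer of Y: the correction b preserves Y, so X is still sent to Y and the
extension reaches everything normalizing both R and X. -/
theorem Good.exists_extend [Fact p.Prime] (hS : IsPGroup p S) (h : Good p F Z Y)
    (hR : F.Iso R Z σ) (hX : F.Iso X Y σ) :
    ∃ τ V W, F.Iso R Z τ ∧ F.Iso X Y τ ∧ R ≤ V ∧ N[R] ⊓ N[X] ≤ V ∧ F.Iso V W τ := by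
  obtain ⟨hYZ, hrec, hsyl⟩ := h
  have hXR : X ≤ R := hX.symm.le_of_le hR.symm hYZ
  obtain ⟨b, hb, τ, V, W, h1, h2, h3, h4⟩ := hrec.exists_extend hS
    (B := stabAut F Z Y) (fun b hb => hb.1) hsyl hR
    (D := N[R] ⊓ N[X]) inf_le_left fun d hd => by
      have hi : F.Iso Z Z (σ * ((MulAut.conj d).toEquiv * σ⁻¹)) :=
        (hR.symm.trans (Iso.of_mem_normalizer F hd.1)).trans hR
      have hi' : F.Iso Y Y (σ * ((MulAut.conj d).toEquiv * σ⁻¹)) :=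
        (hX.symm.trans (Iso.of_mem_normalizer F hd.2)).trans hX
      obtain ⟨b, hb, h1⟩ := hi.exists_aut
      refine ⟨b, ⟨hb, fun z => ?_⟩, fun r hr => ?_⟩
      · rw [← h1, hi'.mem_iff]
      · rw [extendAut_apply b ⟨σ r, hR.mem_iff.2 hr⟩, ← h1]
        simp
  refine ⟨τ, V, W, ?_, ?_, h1, h2, h3⟩
  · exact (hR.trans (iso_extendAut_iff.2 hb.1)).congr h4
  · have h5 : F.Iso Y Y (extendAut b) := (iso_extendAut_iff.2 hb.1).restrict hYZ fun s => by
      by_cases hs : s ∈ Z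
      · rw [extendAut_apply b ⟨s, hs⟩]
        exact hb.2 ⟨s, hs⟩
      · refine iff_of_false (fun h => hs ?_) fun h => hs (hYZ h)
        exact (iso_extendAut_iff.2 hb.1).mem_iff.1 (hYZ h)
    exact (hX.trans h5).congr fun x hx => h4 x (hXR hx)

/-- A variant that preserves σ on X pointwise. Here B consists of the stabilizing automorphisms that
act on Y as conjugation by an element of N(Z) ∩ N(Y). It contains the Sylow subgroup of the
stabilizer, so the Sylow argument remains available. -/
theorem Good.exists_extend_eqOn [Fact p.Prime] (hS : IsPGroup p S) (h : Good p F Z Y)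
    (hR : F.Iso R Z σ) (hX : F.Iso X Y σ) {D : Subgroup S} (hDN : D ≤ N[R] ⊓ N[X])
    (hD : ∀ d ∈ D, ∃ g ∈ N[Z] ⊓ N[Y], ∀ x ∈ X, σ (d * x * d⁻¹) = g * σ x * g⁻¹) :
    ∃ τ V W, F.Iso R Z τ ∧ (∀ x ∈ X, τ x = σ x) ∧ R ≤ V ∧ D ≤ V ∧ F.Iso V W τ := by
  obtain ⟨hYZ, hrec, hsyl⟩ := h
  have hXR : X ≤ R := hX.symm.le_of_le hR.symm hYZ
  let B : Subgroup (MulAut Z) :=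
    { carrier := {b | b ∈ stabAut F Z Y ∧
        ∃ g ∈ N[Z] ⊓ N[Y], ∀ z : Z, (z : S) ∈ Y → (b z : S) = g * z * g⁻¹}
      one_mem' := ⟨one_mem _, 1, one_mem _, fun z _ => by simp⟩
      mul_mem' := by
        rintro a b ⟨ha, g, hg, ha'⟩ ⟨hb, k, hk, hb'⟩
        refine ⟨mul_mem ha hb, g * k, mul_mem hg hk, fun z hz => ?_⟩
        rw [MulAut.mul_apply, ha' _ ((hb.2 z).2 hz), hb' z hz]
        simp [mul_assoc]
      inv_mem' := by
        rintro a ⟨ha, g, hg, ha'⟩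
        refine ⟨inv_mem ha, g⁻¹, inv_mem hg, fun z hz => ?_⟩
        have h1 := ha' (a⁻¹ z) ((inv_mem ha).2 z |>.2 hz)
        rw [MulAut.apply_inv_self] at h1
        rw [h1]
        simp [mul_assoc] }
  have hTB : autS Z ⊓ stabAut F Z Y ≤ B := by
    rintro b ⟨hb, hb'⟩
    obtain ⟨g, hg, h1⟩ := mem_autS_iff.1 hb
    refine ⟨hb', g, ⟨hg, Subgroup.mem_normalizer_iff.2 fun s => ?_⟩, fun z _ => h1 z⟩
    by_cases hs : s ∈ Z
    · rw [← h1 ⟨s, hs⟩]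
      exact (hb'.2 ⟨s, hs⟩).symm
    · refine iff_of_false (fun h => hs (hYZ h)) fun h => hs ?_
      exact (Subgroup.mem_normalizer_iff.1 hg s).2 (hYZ h)
  have hBle : B ≤ stabAut F Z Y := fun b hb => hb.1
  have hBeq : autS Z ⊓ B = autS Z ⊓ stabAut F Z Y :=
    le_antisymm (inf_le_inf_left _ hBle) (le_inf inf_le_left hTB)
  obtain ⟨b, hb, τ, V, W, h1, h2, h3, h4⟩ := hrec.exists_extend hS (B := B) (fun b hb => hb.1.1)
    (by rw [hBeq]; exact hsyl.mono hTB hBle) hR (D := D) (hDN.trans inf_le_left) fun d hd => by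
      have hi : F.Iso Z Z (σ * ((MulAut.conj d).toEquiv * σ⁻¹)) :=
        (hR.symm.trans (Iso.of_mem_normalizer F (hDN hd).1)).trans hR
      have hi' : F.Iso Y Y (σ * ((MulAut.conj d).toEquiv * σ⁻¹)) :=
        (hX.symm.trans (Iso.of_mem_normalizer F (hDN hd).2)).trans hX
      obtain ⟨b, hb, h1⟩ := hi.exists_aut
      obtain ⟨g, hg, h2⟩ := hD d hd
      refine ⟨b, ⟨⟨hb, fun z => ?_⟩, g, hg, fun z hz => ?_⟩, fun r hr => ?_⟩
      · rw [← h1, hi'.mem_iff]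
      · have h3 := h2 _ (hX.symm.mem_iff.2 hz)
        rw [perm_apply_inv] at h3
        rw [← h1, ← h3]
        rfl
      · rw [extendAut_apply b ⟨σ r, hR.mem_iff.2 hr⟩, ← h1]
        simp
  obtain ⟨hbs, g, hg, hbg⟩ := hb
  -- The correction b acts on Y as conjugation by g, so following it with conjugation by g⁻¹
  -- restores σ on X.
  obtain ⟨W', h6⟩ : ∃ W', F.Iso W W' (MulAut.conj g⁻¹).toEquiv :=
    (Iso.conj F (X := ⊤) (Y := ⊤) g⁻¹ (by simp)).exists_restrict le_top |>.imp fun _ h => h.2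
  refine ⟨(MulAut.conj g⁻¹).toEquiv * τ, V, W', ?_, fun x hx => ?_, h1, h2, h3.trans h6⟩
  · exact ((hR.trans (iso_extendAut_iff.2 hbs.1)).congr h4).trans
      (Iso.of_mem_normalizer F (inv_mem hg.1))
  · have hxY : σ x ∈ Y := hX.mem_iff.2 hx
    rw [Equiv.Perm.mul_apply, h4 x (hXR hx), extendAut_apply b ⟨σ x, hYZ hxY⟩, hbg _ hxY]
    simp [mul_assoc]

/-- Take a fully automized receptive conjugate Z of R and adjust by an automorphism of Z, so that
Aut_S(Z) meets the stabilizer of the image of X in a Sylow subgroup. -/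
theorem exists_good [Fact p.Prime] (hS : IsPGroup p S) (hXR : X ≤ R)
    (hsat : ∃ Q : Subgroup S, F.IsConj R Q ∧ F.IsFullyAutomized p Q ∧ F.IsReceptive Q) :
    ∃ Z Y σ V W, Good p F Z Y ∧ F.Iso R Z σ ∧ F.Iso X Y σ ∧ R ≤ V ∧ N[R] ⊓ N[X] ≤ V ∧
      F.Iso V W σ := by
  obtain ⟨Z, hconj, haut, hrec⟩ := hsat
  obtain ⟨σ, hσ⟩ := isConj_iff_exists_iso.1 hconj
  obtain ⟨Y₀, hY₀, hσX⟩ := hσ.exists_restrict hXR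
  obtain ⟨a, ha, hsyl⟩ := (isFullyAutomized_iff.1 haut).exists_conj_inf
    (B := stabAut F Z Y₀) (fun b hb => hb.1)
  have hai := iso_extendAut_iff.2 ha
  obtain ⟨Y, hY, haY⟩ := hai.exists_restrict hY₀
  have haY' : ∀ z : Z, (a z : S) ∈ Y ↔ (z : S) ∈ Y₀ := fun z => by
    rw [← extendAut_apply, haY.mem_iff]
  have hmap : (stabAut F Z Y₀).map (MulAut.conj a).toMonoidHom = stabAut F Z Y := by
    ext b
    constructor
    · rintro ⟨c, hc, rfl⟩
      refine ⟨mul_mem (mul_mem ha hc.1) (inv_mem ha), fun z => ?_⟩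
      change (a (c (a⁻¹ z)) : S) ∈ Y ↔ _
      rw [haY', hc.2, ← haY', MulAut.apply_inv_self]
    · intro hb
      refine ⟨a⁻¹ * b * a, ⟨mul_mem (mul_mem (inv_mem ha) hb.1) ha, fun z => ?_⟩, ?_⟩
      · change (a⁻¹ (b (a z)) : S) ∈ Y₀ ↔ _
        rw [← haY', MulAut.apply_inv_self, hb.2, haY']
      · simp [mul_assoc]
  rw [hmap] at hsyl
  have hgood : Good p F Z Y := ⟨hY, hrec, hsyl⟩
  obtain ⟨τ, V, W, h1, h2, h3, h4, h5⟩ := hgood.exists_extend hS (hσ.trans hai) (hσX.trans haY)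
  exact ⟨Z, Y, τ, V, W, hgood, h1, h2, h3, h4, h5⟩

theorem IsConj.to [Fact p.Prime] (hS : IsPGroup p S) (h : F.IsConj X Y)
    (haut : F.IsFullyAutomized p Y) (hrec : F.IsReceptive Y) : F.To X Y := by
  obtain ⟨σ, hσ⟩ := isConj_iff_exists_iso.1 h
  obtain ⟨τ, V, W, h1, -, -, h4, h5⟩ :=
    (good_self_iff.2 ⟨haut, hrec⟩ : Good p F Y Y).exists_extend hS hσ hσ
  rw [inf_idem] at h4
  exact To.of_le h1 h5 h4

end FusionSystem

/-! ### Generated fusion systems and transport of isomorphisms to a fixed subgroup -/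

namespace FusionSystem

variable {S : Type*} [Group S]

local notation "N[" X "]" => Subgroup.normalizer (X : Set S)

theorem IsConj.refl (F : FusionSystem S) (X : Subgroup S) : F.IsConj X X :=
  (Iso.refl F X).isConj

theorem IsConj.symm {F : FusionSystem S} {X Y : Subgroup S} (h : F.IsConj X Y) :
    F.IsConj Y X := by
  obtain ⟨e, he⟩ := h
  exact ⟨e.symm, F.symm_mem he⟩

theorem IsConj.trans {F : FusionSystem S} {X Y Z : Subgroup S} (h : F.IsConj X Y)
    (h' : F.IsConj Y Z) : F.IsConj X Z := by
  obtain ⟨e, he⟩ := h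
  obtain ⟨e', he'⟩ := h'
  exact ⟨e.trans e', F.comp_mem he he'⟩

theorem IsConj.card_eq {F : FusionSystem S} {X Y : Subgroup S} (h : F.IsConj X Y) :
    Nat.card X = Nat.card Y := by
  obtain ⟨e, -⟩ := h
  exact Nat.card_congr e.toEquiv

/-- The fusion system of all injective homomorphisms induced by a permutation of `S` all of whose
restrictions to subgroups satisfy `Pr`. -/
def ofClosed (Pr : Subgroup S → Subgroup S → Equiv.Perm S → Prop)
    (hconj : ∀ (g : S) (X Y : Subgroup S), (∀ s, g * s * g⁻¹ ∈ Y ↔ s ∈ X) →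
      Pr X Y (MulAut.conj g).toEquiv)
    (htrans : ∀ X Y Z σ τ, Pr X Y σ → Pr Y Z τ → Pr X Z (τ * σ))
    (hsymm : ∀ X Y σ, Pr X Y σ → Pr Y X σ⁻¹) : FusionSystem S where
  Hom X Y := {φ | Function.Injective φ ∧ ∃ σ : Equiv.Perm S, (∀ x : X, σ x = φ x) ∧
    ∀ X' ≤ X, ∀ Y', (∀ s, σ s ∈ Y' ↔ s ∈ X') → Pr X' Y' σ}
  injective h := h.1
  comp_mem {X Y Z φ ψ} := by
    rintro ⟨h1, σ, h2, h3⟩ ⟨h4, τ, h5, h6⟩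
    refine ⟨h4.comp h1, τ * σ, fun x => ?_, fun X' hX' Z' hZ' => ?_⟩
    · rw [Equiv.Perm.mul_apply, h2, h5]
      rfl
    · have hY' : ∀ s, σ s ∈ (X'.subgroupOf X).map (Y.subtype.comp φ) ↔ s ∈ X' := by
        intro s
        constructor
        · rintro ⟨x, hx, hxs⟩
          have : σ x = σ s := (h2 x).trans hxs
          rw [← σ.injective this]
          exact hx
        · exact fun hs => ⟨⟨s, hX' hs⟩, hs, (h2 ⟨s, hX' hs⟩).symm⟩
      refine htrans _ _ _ _ _ (h3 X' hX' _ hY') (h6 _ ?_ Z' fun s => ?_)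
      · rintro _ ⟨x, -, rfl⟩
        exact (φ x).2
      · rw [← σ.apply_symm_apply s, hY', ← hZ']
        rfl
  conj_mem {X Y} φ g h := by
    have h1 : ∀ x : X, (MulAut.conj g⁻¹).toEquiv (x : S) = φ x := fun x => by simp [h]
    refine ⟨fun x y hxy => Subtype.ext ((MulAut.conj g⁻¹).injective ?_), _, h1,
      fun X' _ Y' hY' => hconj g⁻¹ X' Y' hY'⟩
    exact (h1 x).trans ((congrArg Subtype.val hxy).trans (h1 y).symm)
  factor {X Y φ} := by
    rintro ⟨h1, σ, h2, h3⟩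
    have hφ : Function.Injective (Y.subtype.comp φ) := Y.subtype_injective.comp h1
    have hR : (Y.subtype.comp φ).range ≤ Y := by
      rintro _ ⟨x, rfl⟩
      exact (φ x).2
    refine ⟨_, hR, MonoidHom.ofInjective hφ,
      ⟨(MonoidHom.ofInjective hφ).injective, σ, h2, h3⟩,
      ⟨(MonoidHom.ofInjective hφ).symm.injective, σ⁻¹, fun y => ?_, fun X' hX' Y' hY' => ?_⟩, ?_⟩
    · obtain ⟨x, rfl⟩ := (MonoidHom.ofInjective hφ).surjective y
      rw [Equiv.Perm.inv_eq_iff_eq]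
      simp [h2]
      rfl
    · refine hsymm _ _ _ (h3 Y' (fun s hs => ?_) X' fun s => ?_)
      · rw [← perm_inv_apply σ s, hY'] at hs
        obtain ⟨x, hx⟩ := hX' hs
        have : σ x = σ s := (h2 x).trans hx
        rw [← σ.injective this]
        exact x.2
      · rw [← hY', perm_inv_apply]
    · ext x
      rfl

/-- Induction principle for the isomorphisms of a generated fusion system. -/
theorem generate_induction {A : Set (Σ Q : Subgroup S, MulAut Q)}
    (Pr : Subgroup S → Subgroup S → Equiv.Perm S → Prop)
    (hconj : ∀ (g : S) (X Y : Subgroup S), (∀ s, g * s * g⁻¹ ∈ Y ↔ s ∈ X) →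
      Pr X Y (MulAut.conj g).toEquiv)
    (hbase : ∀ (E : Subgroup S) (α : MulAut E), ⟨E, α⟩ ∈ A → ∀ X ≤ E, ∀ Y,
      (∀ s, extendAut α s ∈ Y ↔ s ∈ X) → Pr X Y (extendAut α))
    (hcongr : ∀ X Y σ τ, Pr X Y σ → (∀ x ∈ X, τ x = σ x) → Pr X Y τ)
    (htrans : ∀ X Y Z σ τ, Pr X Y σ → Pr Y Z τ → Pr X Z (τ * σ))
    (hsymm : ∀ X Y σ, Pr X Y σ → Pr Y X σ⁻¹) {X Y : Subgroup S} {σ : Equiv.Perm S}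
    (h : (generate A).Iso X Y σ) : Pr X Y σ := by
  obtain ⟨e, ⟨-, he⟩, hσ⟩ := id h
  -- Minimality of the generated system, applied to the system of maps all of whose restrictions
  -- satisfy `Pr`. Requiring this for all restrictions makes that system closed under factorization.
  obtain ⟨-, τ, h1, h2⟩ := he (ofClosed Pr hconj htrans hsymm) (by
    rintro ⟨E, α⟩ hx
    exact ⟨α.injective, extendAut α, extendAut_apply α, hbase E α hx⟩)
  replace h1 : ∀ x : X, τ x = e x := h1
  refine hcongr X Y τ σ (h2 X le_rfl Y fun s => ?_) fun x hx => ?_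
  · constructor
    · intro hs
      obtain ⟨x, hx⟩ := e.surjective ⟨_, hs⟩
      have : τ x = τ s := by rw [h1, hx]
      rw [← τ.injective this]
      exact x.2
    · intro hs
      rw [h1 ⟨s, hs⟩]
      exact (e _).2
  · rw [hσ ⟨x, hx⟩, h1 ⟨x, hx⟩]

theorem mem_aut_generate {A : Set (Σ Q : Subgroup S, MulAut Q)} {E : Subgroup S} {α : MulAut E}
    (h : ⟨E, α⟩ ∈ A) : α ∈ (generate A).Aut E :=
  ⟨α.injective, fun _ hG => hG _ h⟩

theorem generate_iso_le {A : Set (Σ Q : Subgroup S, MulAut Q)} {F : FusionSystem S}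
    (hA : ∀ x ∈ A, x.2 ∈ F.Aut x.1) {X Y : Subgroup S} {σ : Equiv.Perm S}
    (h : (generate A).Iso X Y σ) : F.Iso X Y σ := by
  obtain ⟨e, ⟨-, he⟩, hσ⟩ := h
  exact ⟨e, he F hA, hσ⟩

theorem mem_extAut_of_iso {F : FusionSystem S} {Q V W : Subgroup S} {α : MulAut Q}
    (hα : α ∈ F.Aut Q) {ρ : Equiv.Perm S} (hρ : F.Iso V W ρ) (hV : Q < V)
    (h : ∀ x : Q, ρ x = α x) : α ∈ F.extAut Q := by
  have hW : Q < W := (iso_of_mem_aut hα h).lt_of_lt hρ hV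
  obtain ⟨e, he, h1⟩ := hρ
  refine Subgroup.subset_closure ⟨hα, V, W, hV, hW, e, he, fun x => ?_⟩
  rw [← h]
  exact (h1 ⟨x, hV.le x.2⟩).symm

theorem extAut_le_aut (F : FusionSystem S) (Q : Subgroup S) : F.extAut Q ≤ F.Aut Q := by
  rw [extAut, Subgroup.closure_le]
  exact fun α h => h.1

/-- `σ : X → Y` becomes an element of `K ≤ Aut(Q)` when `X` and `Y` are moved to `Q` along any
morphisms defined on their normalizers. -/
def Transports (F : FusionSystem S) {Q : Subgroup S} (K : Subgroup (MulAut Q))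
    (X Y : Subgroup S) (σ : Equiv.Perm S) : Prop :=
  F.Iso X Y σ ∧ ∀ (χ χ' : Equiv.Perm S) (W W' : Subgroup S), F.Iso X Q χ → F.Iso N[X] W χ →
    F.Iso Y Q χ' → F.Iso N[Y] W' χ' → ∃ α ∈ K, ∀ x ∈ X, χ' (σ x) = extendAut α (χ x)

namespace Transports

variable {F : FusionSystem S} {Q : Subgroup S} {K : Subgroup (MulAut Q)} {X Y Z : Subgroup S}
  {σ τ : Equiv.Perm S}

theorem congr (h : F.Transports K X Y σ) (hτ : ∀ x ∈ X, τ x = σ x) : F.Transports K X Y τ := by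
  refine ⟨h.1.congr hτ, fun χ χ' W W' h1 h2 h3 h4 => ?_⟩
  obtain ⟨α, hα, h5⟩ := h.2 χ χ' W W' h1 h2 h3 h4
  exact ⟨α, hα, fun x hx => by rw [hτ x hx, h5 x hx]⟩

theorem symm (h : F.Transports K X Y σ) : F.Transports K Y X σ⁻¹ := by
  refine ⟨h.1.symm, fun χ χ' W W' h1 h2 h3 h4 => ?_⟩
  obtain ⟨α, hα, h5⟩ := h.2 χ' χ W' W h3 h4 h1 h2
  refine ⟨α⁻¹, inv_mem hα, fun y hy => ?_⟩
  have hx : σ⁻¹ y ∈ X := h.1.symm.mem_iff.2 hy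
  have h6 := h5 _ hx
  have h7 : χ' (σ⁻¹ y) ∈ Q := h3.mem_iff.2 hx
  rw [perm_apply_inv, extendAut_apply α ⟨_, h7⟩] at h6
  rw [h6, extendAut_apply, MulAut.inv_apply_self]

/-- The intermediate subgroup Y also has a map to Q defined on its normalizer, and comparing both
factors along it multiplies the two elements of K. -/
theorem trans (hto : ∀ X, F.IsConj X Q → F.To X Q) (h : F.Transports K X Y σ)
    (h' : F.Transports K Y Z τ) : F.Transports K X Z (τ * σ) := by
  refine ⟨h.1.trans h'.1, fun χ χ' W W' h1 h2 h3 h4 => ?_⟩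
  obtain ⟨ξ, V, h5, -, h6⟩ := hto Y (h.1.isConj.symm.trans h1.isConj)
  obtain ⟨α, hα, h7⟩ := h.2 χ ξ W V h1 h2 h5 h6
  obtain ⟨β, hβ, h8⟩ := h'.2 ξ χ' V W' h5 h6 h3 h4
  refine ⟨β * α, mul_mem hβ hα, fun x hx => ?_⟩
  have hxQ : χ x ∈ Q := h1.mem_iff.2 hx
  rw [Equiv.Perm.mul_apply, h8 _ (h.1.mem_iff.2 hx), h7 x hx, extendAut_apply α ⟨_, hxQ⟩,
    extendAut_apply, extendAut_apply (β * α) ⟨_, hxQ⟩, MulAut.mul_apply]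

theorem exists_mem (h : F.Transports K Q Q σ) : ∃ α ∈ K, ∀ x : Q, σ x = α x := by
  obtain ⟨α, hα, h1⟩ := h.2 1 1 _ _ (Iso.refl F Q) (Iso.refl F _) (Iso.refl F Q) (Iso.refl F _)
  exact ⟨α, hα, fun x => by simpa [extendAut_apply] using h1 x x.2⟩

variable [Finite S] {p : ℕ} [Fact p.Prime]

/-- Normalizers grow, so σ, χ and χ' are all defined beyond X and Y, and the transported
automorphism of Q extends beyond Q. -/
theorem of_extends (hS : IsPGroup p S) (hK : F.extAut Q ≤ K) {R R' : Subgroup S} (h : F.Iso X Y σ)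
    (hXR : X < R) (hR : F.Iso R R' σ) : F.Transports K X Y σ := by
  refine ⟨h, fun χ χ' W W' h1 h2 h3 h4 => ?_⟩
  have hlt := hS.lt_inf_normalizer hXR
  obtain ⟨V₁, -, h5⟩ := h2.exists_restrict (X := R ⊓ N[X]) inf_le_right
  obtain ⟨V₂, -, h6⟩ := hR.exists_restrict (X := R ⊓ N[X]) inf_le_left
  obtain ⟨V₃, -, h7⟩ := h4.exists_restrict (h6.le_normalizer h hlt.le inf_le_right)
  have hQ : Q < V₁ := h1.lt_of_lt h5 hlt
  obtain ⟨α, hα, h8⟩ := ((h1.symm.trans h).trans h3).exists_aut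
  refine ⟨α, hK (mem_extAut_of_iso hα ((h5.symm.trans h6).trans h7) hQ h8), fun x hx => ?_⟩
  rw [extendAut_apply α ⟨χ x, h1.mem_iff.2 hx⟩, ← h8]
  simp

/-- Changing the maps χ, χ' changes the transported automorphism only by automorphisms that extend
to the normalizer of Q, and these lie in K. -/
theorem of_mem (hS : IsPGroup p S) (hQ : Q < ⊤) (hK : F.extAut Q ≤ K) (hKF : K ≤ F.Aut Q)
    {α : MulAut Q} (hα : α ∈ K) : F.Transports K Q Q (extendAut α) := by
  refine ⟨iso_extendAut_iff.2 (hKF hα), fun χ χ' W W' h1 h2 h3 h4 => ?_⟩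
  have hlt : Q < N[Q] := by simpa using hS.lt_inf_normalizer hQ
  obtain ⟨β, hβ, h5⟩ := h1.exists_aut
  obtain ⟨γ, hγ, h6⟩ := h3.exists_aut
  have hβK := hK (mem_extAut_of_iso hβ h2 hlt h5)
  have hγK := hK (mem_extAut_of_iso hγ h4 hlt h6)
  refine ⟨γ * α * β⁻¹, mul_mem (mul_mem hγK hα) (inv_mem hβK), fun x hx => ?_⟩
  rw [extendAut_apply α ⟨x, hx⟩, h6, h5 ⟨x, hx⟩, extendAut_apply]
  simp

end Transports

end FusionSystem

/-! ### Saturation at non-centric classes -/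

namespace FusionSystem

variable {S : Type*} [Group S]

local notation "N[" X "]" => Subgroup.normalizer (X : Set S)
local notation "C[" X "]" => Subgroup.centralizer (X : Set S)

/-- Some `F`-conjugate of `X` is fully automized and receptive. -/
def IsSaturatedAt (p : ℕ) (F : FusionSystem S) (X : Subgroup S) : Prop :=
  ∃ Q : Subgroup S, F.IsConj X Q ∧ F.IsFullyAutomized p Q ∧ F.IsReceptive Q

theorem lt_of_le_of_card_lt {X Y : Subgroup S} (h : X ≤ Y) (hc : Nat.card X < Nat.card Y) :
    X < Y :=
  lt_of_le_of_ne h (by rintro rfl; exact hc.false)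

/-- `X C_S(X)`. -/
def supCentralizer (X : Subgroup S) : Subgroup S := X ⊔ C[X]

theorem le_supCentralizer (X : Subgroup S) : X ≤ supCentralizer X := le_sup_left

theorem centralizer_le_supCentralizer (X : Subgroup S) : C[X] ≤ supCentralizer X := le_sup_right

theorem supCentralizer_le_normalizer (X : Subgroup S) : supCentralizer X ≤ N[X] :=
  sup_le Subgroup.le_normalizer (Subgroup.centralizer_le_normalizer _)

theorem normalizer_le_normalizer_centralizer (X : Subgroup S) : N[X] ≤ N[C[X]] :=
  (Subgroup.normal_subgroupOf_iff_le_normalizer (Subgroup.centralizer_le_normalizer _)).1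
    (Subgroup.normal_subgroupOf_centralizer_normalizer _)

theorem normalizer_le_normalizer_supCentralizer (X : Subgroup S) :
    N[X] ≤ N[supCentralizer X] := by
  have key : ∀ g ∈ N[X], ∀ s ∈ supCentralizer X, g * s * g⁻¹ ∈ supCentralizer X := by
    intro g hg s hs
    have h1 : supCentralizer X ≤ (supCentralizer X).comap (MulAut.conj g).toMonoidHom := by
      refine sup_le (fun x hx => ?_) fun x hx => ?_
      · exact le_supCentralizer X ((Subgroup.mem_normalizer_iff.1 hg x).1 hx)
      · exact centralizer_le_supCentralizer X ((Subgroup.mem_normalizer_iff.1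
          (normalizer_le_normalizer_centralizer X hg) x).1 hx)
    exact h1 hs
  refine fun g hg => Subgroup.mem_normalizer_iff.2 fun s => ⟨key g hg s, fun hs => ?_⟩
  have := key g⁻¹ (inv_mem hg) _ hs
  simpa [mul_assoc] using this

/-- Isomorphisms carry `X C_S(X)` into `Y C_S(Y)`. -/
theorem Iso.le_supCentralizer {F : FusionSystem S} {X Y R R' W : Subgroup S} {σ : Equiv.Perm S}
    (hR : F.Iso R R' σ) (h : F.Iso X Y σ) (hXR : supCentralizer X ≤ R)
    (hW : F.Iso (supCentralizer X) W σ) : W ≤ supCentralizer Y := by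
  have hX : X ≤ R := (FusionSystem.le_supCentralizer X).trans hXR
  obtain ⟨V, -, hV⟩ := hR.symm.exists_restrict (X := supCentralizer Y ⊓ R') inf_le_right
  have hmem : ∀ s, s ∈ V ↔ σ s ∈ supCentralizer Y ⊓ R' := fun s => hV.symm.mem_iff.symm
  have hle : supCentralizer X ≤ V := by
    refine sup_le (fun x hx => (hmem x).2 ⟨?_, hR.mem_iff.2 (hX hx)⟩) fun x hx => ?_
    · exact FusionSystem.le_supCentralizer Y (h.mem_iff.2 hx)
    · have hxR := hXR (centralizer_le_supCentralizer X hx)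
      exact (hmem x).2 ⟨centralizer_le_supCentralizer Y ((hR.mem_centralizer_iff hX h hxR).2 hx),
        hR.mem_iff.2 hxR⟩
  exact (hW.le_of_le hV.symm hle).trans inf_le_left

variable [Finite S] {F : FusionSystem S} {p : ℕ} [Fact p.Prime]

theorem card_lt_of_lt {X Y : Subgroup S} (h : X < Y) : Nat.card X < Nat.card Y :=
  lt_of_le_of_ne (Subgroup.card_le_of_le h.le) fun heq =>
    h.ne (Subgroup.eq_of_le_of_card_ge h.le heq.ge)

/-- Induction on the index of R. Through a good pair for X ≤ R, both X and Y reach one subgroup Q₄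
by maps on N(R) ∩ N(X) and N(R') ∩ N(Y), which are larger than R and R'. By induction X and Q₄ have
a common target Q₅, and Y and Q₄ a common target Q₆. The targets Q₅, Q₆ are joined through N(Q₄),
which is again larger than R. -/
theorem exists_common_to (hS : IsPGroup p S) {c : ℕ}
    (hsat : ∀ R : Subgroup S, c < Nat.card R → F.IsSaturatedAt p R) (n : ℕ) :
    ∀ (X Y R R' : Subgroup S) (σ : Equiv.Perm S), Nat.card X = c → F.Iso X Y σ → X < R →
      R ≤ N[X] → F.Iso R R' σ → Nat.card S ≤ Nat.card R + n → ∃ Q, F.To X Q ∧ F.To Y Q := by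
  induction n with
  | zero =>
    intro X Y R R' σ _ h _ _ hR hn
    have : R = ⊤ := Subgroup.eq_top_of_le_card _ hn
    subst this
    exact ⟨Y, To.of_le h hR le_top, To.refl F Y⟩
  | succ n ih =>
    intro X Y R R' σ hc h hXR hRN hR hn
    by_cases hNR : N[X] ≤ R
    · exact ⟨Y, To.of_le h hR hNR, To.refl F Y⟩
    have hRN' : R' ≤ N[Y] := hR.le_normalizer h hXR.le hRN
    by_cases hNR' : N[Y] ≤ R'
    · exact ⟨X, To.refl F X, To.of_le h.symm hR.symm hNR'⟩
    have hlt := hS.lt_inf_normalizer (lt_of_le_not_ge hRN hNR)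
    have hlt' := hS.lt_inf_normalizer (lt_of_le_not_ge hRN' hNR')
    rw [inf_comm] at hlt hlt'
    obtain ⟨Z, Q₄, χ, V, W, hgood, hχR, hχX, -, hV, hχV⟩ := exists_good hS hXR.le
      (hsat R (hc ▸ card_lt_of_lt hXR))
    obtain ⟨R₁, -, hR₁⟩ := hχV.exists_restrict hV
    have hXR₁ := hXR.trans hlt
    have hcard := card_lt_of_lt hlt
    obtain ⟨Q₅, h5, h5'⟩ := ih X Q₄ _ R₁ χ hc hχX hXR₁ inf_le_right hR₁ (by omega)
    obtain ⟨τ, V', W', -, hτY, -, hV', hτV⟩ :=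
      hgood.exists_extend hS (hR.symm.trans hχR) (h.symm.trans hχX)
    obtain ⟨R₂, -, hR₂⟩ := hτV.exists_restrict hV'
    have hcard' := card_lt_of_lt hlt'
    have hRR' := hR.card_eq
    obtain ⟨Q₆, h6, h6'⟩ := ih Y Q₄ _ R₂ τ (h.card_eq ▸ hc) hτY ((h.lt_of_lt hR hXR).trans hlt')
      inf_le_right hR₂ (by omega)
    obtain ⟨θ, W₅, h7, h8, h9⟩ := id h5'
    obtain ⟨θ', W₆, h7', h8', h9'⟩ := id h6'
    have hR₁Q : Nat.card (N[R] ⊓ N[X] : Subgroup S) ≤ Nat.card W₅ := by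
      rw [hR₁.card_eq, ← h9.card_eq]
      exact Subgroup.card_le_of_le (hR₁.le_normalizer hχX hXR₁.le inf_le_right)
    have hQ₅c : Nat.card Q₅ = c := by rw [← h7.card_eq, ← hχX.card_eq, hc]
    have hlt₅ : Q₅ < W₅ := by
      refine lt_of_le_of_card_lt (h7.le_of_le h9 Subgroup.le_normalizer) ?_
      have := card_lt_of_lt hXR₁
      omega
    obtain ⟨Q₇, h10, h11⟩ := ih Q₅ Q₆ W₅ W₆ (θ' * θ⁻¹) hQ₅c (h7.symm.trans h7') hlt₅ h8
      (h9.symm.trans h9') (by omega)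
    exact ⟨Q₇, h5.trans h10, h6.trans h11⟩

/-- The isomorphisms of `F` between conjugates of `X₀` are generated by those that extend to
strictly larger subgroups. -/
def GeneratedAbove (F : FusionSystem S) (X₀ : Subgroup S) : Prop :=
  ∀ Pr : Subgroup S → Subgroup S → Equiv.Perm S → Prop,
    (∀ X Y σ τ, Pr X Y σ → (∀ x ∈ X, τ x = σ x) → Pr X Y τ) →
    (∀ X Y Z σ τ, Pr X Y σ → Pr Y Z τ → Pr X Z (τ * σ)) →
    (∀ X Y σ, Pr X Y σ → Pr Y X σ⁻¹) →
    (∀ X Y R R' σ, F.IsConj X₀ X → X < R → F.Iso X Y σ → F.Iso R R' σ → Pr X Y σ) →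
    ∀ X Y σ, F.IsConj X₀ X → F.Iso X Y σ → Pr X Y σ

/-- A confluence argument: arrows `F.To` out of one subgroup can be joined, hence so can any two
conjugates, because the isomorphisms are composites of ones that extend. -/
theorem exists_to_of_generatedAbove (hS : IsPGroup p S) {X₀ : Subgroup S} (hX₀ : X₀ < ⊤)
    (hsat : ∀ R : Subgroup S, Nat.card X₀ < Nat.card R → F.IsSaturatedAt p R)
    (hgen : F.GeneratedAbove X₀) : ∃ Q, F.IsConj X₀ Q ∧ ∀ X, F.IsConj X₀ X → F.To X Q := by
  have hlt : ∀ X, F.IsConj X₀ X → X < N[X] := fun X hX => by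
    have : X < ⊤ := lt_of_le_of_card_lt le_top (hX.card_eq ▸ card_lt_of_lt hX₀)
    simpa using hS.lt_inf_normalizer this
  have hconf : ∀ X Y Z, F.IsConj X₀ X → F.To X Y → F.To X Z → ∃ Q, F.To Y Q ∧ F.To Z Q := by
    rintro X Y Z hX ⟨σ, W, h1, h2, h3⟩ ⟨τ, V, h4, h5, h6⟩
    exact exists_common_to hS hsat (Nat.card S) Y Z W V (τ * σ⁻¹)
      (h1.card_eq.symm.trans hX.card_eq.symm) (h1.symm.trans h4) (h1.lt_of_lt h3 (hlt X hX)) h2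
      (h3.symm.trans h6) (Nat.le_add_left _ _)
  have hjoin : ∀ X Y σ, F.IsConj X₀ X → F.Iso X Y σ →
      F.Iso X Y σ ∧ (F.IsConj X₀ X → ∃ Q, F.To X Q ∧ F.To Y Q) := by
    refine hgen _ ?_ ?_ ?_ ?_
    · exact fun X Y σ τ h hτ => ⟨h.1.congr hτ, h.2⟩
    · rintro X Y Z σ τ ⟨h1, h2⟩ ⟨h3, h4⟩
      refine ⟨h1.trans h3, fun hX => ?_⟩
      have hY := hX.trans h1.isConj
      obtain ⟨Q₁, h5, h6⟩ := h2 hX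
      obtain ⟨Q₂, h7, h8⟩ := h4 hY
      obtain ⟨Q, h9, h10⟩ := hconf Y Q₁ Q₂ hY h6 h7
      exact ⟨Q, h5.trans h9, h8.trans h10⟩
    · rintro X Y σ ⟨h1, h2⟩
      refine ⟨h1.symm, fun hY => ?_⟩
      obtain ⟨Q, h3, h4⟩ := h2 (hY.trans h1.isConj.symm)
      exact ⟨Q, h4, h3⟩
    · intro X Y R R' σ hX hXR h hR
      refine ⟨h, fun _ => ?_⟩
      have hlt' := hS.lt_inf_normalizer hXR
      obtain ⟨V, -, hV⟩ := hR.exists_restrict (X := R ⊓ N[X]) inf_le_left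
      exact exists_common_to hS hsat (Nat.card S) X Y _ V σ hX.card_eq.symm h hlt'
        inf_le_right hV (Nat.le_add_left _ _)
  -- No arrow leaving Q enlarges the normalizer, so every arrow leaving Q is reversible.
  obtain ⟨Q, hQ, hmax⟩ := Set.exists_max_image {X : Subgroup S | F.IsConj X₀ X}
    (fun X => Nat.card N[X]) (Set.toFinite _) ⟨X₀, IsConj.refl F X₀⟩
  refine ⟨Q, hQ, fun X hX => ?_⟩
  obtain ⟨σ, hσ⟩ := isConj_iff_exists_iso.1 (hX.symm.trans hQ)
  obtain ⟨Y, h1, h2⟩ := (hjoin X Q σ hX hσ).2 hX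
  exact h1.trans (h2.symm_of_card (hmax Y (hX.trans h1.isConj)))

theorem exists_extend_supCentralizer_of_le {Q R R' : Subgroup S} {σ : Equiv.Perm S}
    (h : F.Iso Q Q σ) (hR : F.Iso R R' σ) (hle : supCentralizer Q ≤ R) :
    F.Iso (supCentralizer Q) (supCentralizer Q) σ := by
  obtain ⟨W, -, hW⟩ := hR.exists_restrict hle
  have hWle := hR.le_supCentralizer h hle hW
  have := Subgroup.eq_of_le_of_card_ge hWle hW.card_eq.le
  rwa [this] at hW

/-- Enlarge the domain until it contains C(Q). With a good pair (Z, Q₄) for Q ≤ R, write σ on Q as a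
quotient of two maps Q → Q₄, each extending beyond R or R'. Returning to Q by θ makes both
automorphisms of Q covered by induction. -/
theorem exists_extend_supCentralizer (hS : IsPGroup p S) {Q : Subgroup S}
    (hto : ∀ X, F.IsConj X Q → F.To X Q)
    (hsat : ∀ R : Subgroup S, Nat.card Q < Nat.card R → F.IsSaturatedAt p R) (n : ℕ) :
    ∀ (R R' : Subgroup S) (σ : Equiv.Perm S), F.Iso Q Q σ → Q < R → R ≤ N[Q] → F.Iso R R' σ →
      Nat.card S ≤ Nat.card R + n →
      ∃ τ, F.Iso (supCentralizer Q) (supCentralizer Q) τ ∧ ∀ x ∈ Q, τ x = σ x := by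
  induction n with
  | zero =>
    intro R R' σ h _ _ hR hn
    have : R = ⊤ := Subgroup.eq_top_of_le_card _ hn
    subst this
    exact ⟨σ, exists_extend_supCentralizer_of_le h hR le_top, fun _ _ => rfl⟩
  | succ n ih =>
    intro R R' σ h hQR hRN hR hn
    by_cases hCR : C[Q] ≤ R
    · exact ⟨σ, exists_extend_supCentralizer_of_le h hR (sup_le hQR.le hCR), fun _ _ => rfl⟩
    have hQR' : Q < R' := h.lt_of_lt hR hQR
    by_cases hCR' : C[Q] ≤ R'
    · have := exists_extend_supCentralizer_of_le h.symm hR.symm (sup_le hQR'.le hCR')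
      exact ⟨σ, by simpa using this.symm, fun _ _ => rfl⟩
    have hRN' : R' ≤ N[Q] := hR.le_normalizer h hQR.le hRN
    have hlt : R < N[R] ⊓ N[Q] := by
      rw [inf_comm]
      exact hS.lt_inf_normalizer (lt_of_le_of_ne hRN fun heq =>
        hCR (heq ▸ Subgroup.centralizer_le_normalizer _))
    obtain ⟨Z, Q₄, χ, V, W, hgood, hχR, hχX, -, hV, hχV⟩ := exists_good hS hQR.le
      (hsat R (card_lt_of_lt hQR))
    obtain ⟨θ, W₁, hθQ, hW₁, hθ⟩ := hto Q₄ hχX.symm.isConj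
    have key : ∀ (U U' : Subgroup S) (ρ : Equiv.Perm S), F.Iso U U' ρ → F.Iso Q Q₄ ρ →
        Q < U → U ≤ N[Q] → Nat.card R < Nat.card U →
        ∃ τ, F.Iso (supCentralizer Q) (supCentralizer Q) τ ∧ ∀ x ∈ Q, τ x = (θ * ρ) x := by
      intro U U' ρ hU hρ hQU hUN hc
      obtain ⟨U'', -, hU''⟩ := hθ.exists_restrict (hU.le_normalizer hρ hQU.le hUN)
      exact ih U U'' _ (hρ.trans hθQ) hQU hUN (hU.trans hU'') (by omega)
    obtain ⟨R₁, -, hR₁⟩ := hχV.exists_restrict hV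
    obtain ⟨τ₁, h1, h1'⟩ := key _ R₁ χ hR₁ hχX (hQR.trans hlt) inf_le_right (card_lt_of_lt hlt)
    obtain ⟨ξ, V', W', -, hξQ, hRV', hDV', hξV⟩ := hgood.exists_extend_eqOn hS
      (hR.symm.trans hχR) (h.symm.trans hχX) (D := N[R'] ⊓ C[Q])
      (inf_le_inf_left _ (Subgroup.centralizer_le_normalizer _)) fun d hd => by
        -- Elements centralizing Q act trivially on it, so the identity realizes their transported
        -- action.
        refine ⟨1, one_mem _, fun x hx => ?_⟩
        have h2 := Subgroup.mem_centralizer_iff.1 hd.2 x hx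
        rw [← h2]
        simp
    have hξ : F.Iso Q Q₄ ξ := (h.symm.trans hχX).congr hξQ
    -- R' grows inside R'C(Q). An element of R'C(Q) normalizing R' is a product of an element of R'
    -- and one centralizing Q and normalizing R', and ξ is defined on the latter.
    have hRV'' : R' < V' ⊓ N[Q] := by
      refine lt_of_le_of_ne (le_inf hRV' hRN') fun heq => ?_
      have hlt' : R' < R' ⊔ C[Q] := lt_of_le_of_ne le_sup_left fun heq =>
        hCR' (heq ▸ le_sup_right)
      obtain ⟨m, hm, hmR⟩ := SetLike.exists_of_lt (hS.lt_inf_normalizer hlt')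
      have hm' : m ∈ ((R' ⊔ C[Q] : Subgroup S) : Set S) := hm.1
      rw [Subgroup.coe_mul_of_left_le_normalizer_right _ _
        (hRN'.trans (normalizer_le_normalizer_centralizer Q))] at hm'
      obtain ⟨r, hr, d, hd, rfl⟩ := hm'
      refine hmR (R'.mul_mem hr ?_)
      rw [heq]
      refine ⟨hDV' ⟨?_, hd⟩, Subgroup.centralizer_le_normalizer _ hd⟩
      have := mul_mem (inv_mem (Subgroup.le_normalizer hr)) hm.2
      simpa using this
    obtain ⟨R₂, -, hR₂⟩ := hξV.exists_restrict (X := V' ⊓ N[Q]) inf_le_left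
    obtain ⟨τ₂, h2, h2'⟩ := key _ R₂ ξ hR₂ hξ (hQR'.trans hRV'') inf_le_right
      (hR.card_eq ▸ card_lt_of_lt hRV'')
    refine ⟨τ₂⁻¹ * τ₁, h1.trans h2.symm, fun x hx => ?_⟩
    rw [Equiv.Perm.mul_apply, Equiv.Perm.inv_eq_iff_eq, h1' x hx, h2' _ (h.mem_iff.2 hx)]
    simp [hξQ _ (h.mem_iff.2 hx)]

/-- Restriction to `Y` of the `F`-automorphisms of `Z` stabilizing `Y`. -/
def restrictAut (F : FusionSystem S) {Z Y : Subgroup S} (hY : Y ≤ Z) :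
    stabAut F Z Y →* MulAut Y where
  toFun b :=
    { toFun := fun y => ⟨b.1 ⟨y, hY y.2⟩, (b.2.2 _).2 y.2⟩
      invFun := fun y => ⟨b.1⁻¹ ⟨y, hY y.2⟩, ((inv_mem b.2).2 _).2 y.2⟩
      left_inv := fun y => Subtype.ext
        (Subtype.ext_iff.1 (MulAut.inv_apply_self Z b.1 ⟨y, hY y.2⟩) :)
      right_inv := fun y => Subtype.ext
        (Subtype.ext_iff.1 (MulAut.apply_inv_self Z b.1 ⟨y, hY y.2⟩) :)
      map_mul' := fun x y => Subtype.ext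
        (Subtype.ext_iff.1 (map_mul b.1 ⟨x, hY x.2⟩ ⟨y, hY y.2⟩) :) }
  map_one' := rfl
  map_mul' _ _ := rfl

/-- Restriction from the stabilizer of Q in Aut_F(Z) to Aut_F(Q) is surjective by `hext`, and
surjections carry Sylow subgroups to Sylow subgroups. Since N(Q) ≤ N(Z), the image of the Sylow
subgroup is all of Aut_S(Q). -/
theorem Good.isFullyAutomized {Z Q : Subgroup S} (hgood : Good p F Z Q)
    (hN : N[Q] ≤ N[Z])
    (hext : ∀ α ∈ F.Aut Q, ∃ τ, F.Iso Z Z τ ∧ ∀ x : Q, τ x = α x) :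
    F.IsFullyAutomized p Q := by
  obtain ⟨hQZ, -, hsyl⟩ := hgood
  have hmem : ∀ b : stabAut F Z Q, restrictAut F hQZ b ∈ F.Aut Q := fun b => by
    rw [← iso_extendAut_iff]
    have h1 : F.Iso Q Q (extendAut b.1) := (iso_extendAut_iff.2 b.2.1).restrict hQZ fun s => by
      by_cases hs : s ∈ Z
      · rw [extendAut_apply b.1 ⟨s, hs⟩]
        exact b.2.2 ⟨s, hs⟩
      · refine iff_of_false (fun h => hs ?_) fun h => hs (hQZ h)
        exact (iso_extendAut_iff.2 b.2.1).mem_iff.1 (hQZ h)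
    refine h1.congr fun x hx => ?_
    rw [extendAut_apply b.1 ⟨x, hQZ hx⟩, extendAut_apply _ ⟨x, hx⟩]
    rfl
  let f := (restrictAut F hQZ).codRestrict (F.Aut Q) hmem
  have hf : Function.Surjective f := by
    rintro ⟨α, hα⟩
    obtain ⟨τ, h1, h2⟩ := hext α hα
    obtain ⟨b, hb, h3⟩ := h1.exists_aut
    have h4 : F.Iso Q Q τ := iso_of_mem_aut hα h2
    refine ⟨⟨b, hb, fun z => ?_⟩, Subtype.ext (MulEquiv.ext fun x => Subtype.ext ?_)⟩
    · rw [← h3, h4.mem_iff]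
    · rw [← h2]
      exact (h3 ⟨x, hQZ x.2⟩).symm
  obtain ⟨T, hT⟩ := hsyl.exists_sylow
  have hT' : ∀ b : stabAut F Z Q, b ∈ T ↔ b.1 ∈ autS Z := fun b => by
    have : b.1 ∈ (T : Subgroup (stabAut F Z Q)).map (stabAut F Z Q).subtype ↔ b ∈ T := by
      constructor
      · rintro ⟨c, hc, hcb⟩
        rwa [← Subtype.ext hcb]
      · exact fun h => ⟨b, h, rfl⟩
    rw [← this, hT]
    exact and_iff_left b.2
  refine ⟨T.mapSurjective hf, ?_⟩
  ext α
  constructor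
  · rintro ⟨_, ⟨b, hb, rfl⟩, rfl⟩
    obtain ⟨g, hg, h1⟩ := mem_autS_iff.1 ((hT' b).1 hb)
    refine mem_autS_iff.2 ⟨g, Subgroup.mem_normalizer_iff.2 fun s => ?_, fun x => h1 ⟨x, hQZ x.2⟩⟩
    by_cases hs : s ∈ Z
    · rw [← h1 ⟨s, hs⟩]
      exact (b.2.2 ⟨s, hs⟩).symm
    · refine iff_of_false (fun h => hs (hQZ h)) fun h => hs ?_
      exact (Subgroup.mem_normalizer_iff.1 hg s).2 (hQZ h)
  · intro hα
    obtain ⟨g, hg, h1⟩ := mem_autS_iff.1 hα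
    let b : MulAut Z := Z.normalizerMonoidHom ⟨g, hN hg⟩
    have hb : b ∈ autS Z := ⟨_, rfl⟩
    have hb' : b ∈ stabAut F Z Q :=
      ⟨autS_le_aut F Z hb, fun z => (Subgroup.mem_normalizer_iff.1 hg z).symm⟩
    refine ⟨f ⟨b, hb'⟩, ⟨⟨b, hb'⟩, (hT' _).2 hb, rfl⟩, ?_⟩
    exact MulEquiv.ext fun x => Subtype.ext (h1 x).symm

/-- Factor σ as a map φ defined on all of N(X), followed by an automorphism of Q. The latter extends
to Z, where `Good.exists_extend_eqOn` extends it further over φ(D) without changing it on Q. -/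
theorem Good.isReceptive (hS : IsPGroup p S) {Z Q : Subgroup S} (hgood : Good p F Z Q)
    (hN : N[Q] ≤ N[Z]) (hto : ∀ X, F.IsConj X Q → F.To X Q)
    (hext : ∀ α ∈ F.Aut Q, ∃ τ, F.Iso Z Z τ ∧ ∀ x : Q, τ x = α x) :
    F.IsReceptive Q := by
  rw [isReceptive_iff]
  intro X σ hσ D hD hDc
  obtain ⟨φ, W, hφX, hWN, hφ⟩ := hto X hσ.isConj
  obtain ⟨α, hα, h1⟩ := (hφX.symm.trans hσ).exists_aut
  obtain ⟨β, hβ, h2⟩ := hext α hα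
  have hβQ : F.Iso Q Q β := iso_of_mem_aut hα h2
  have hβ' : ∀ x ∈ X, β (φ x) = σ x := fun x hx => by
    rw [h2 ⟨φ x, hφX.mem_iff.2 hx⟩, ← h1]
    simp
  obtain ⟨D', hD'W, hφD⟩ := hφ.exists_restrict hD
  have hD'N := hD'W.trans hWN
  obtain ⟨τ, V, U, hτ, hτQ, hZV, hD'V, hτV⟩ := hgood.exists_extend_eqOn hS hβ hβQ (D := D')
    (le_inf (hD'N.trans hN) hD'N) fun d hd => by
      have hd' : φ⁻¹ d ∈ D := hφD.symm.mem_iff.2 hd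
      obtain ⟨g, hg, h3⟩ := hDc _ hd'
      refine ⟨g, ⟨hN hg, hg⟩, fun x hx => ?_⟩
      have hx' : φ⁻¹ x ∈ X := hφX.symm.mem_iff.2 hx
      have h4 := hφ.map_conj (hD hd') (Subgroup.le_normalizer hx')
      rw [perm_apply_inv, perm_apply_inv] at h4
      have h5 := hβ' _ ((Subgroup.mem_normalizer_iff.1 (hD hd') _).1 hx')
      have h6 := hβ' _ hx'
      rw [perm_apply_inv] at h6
      rw [← h4, h5, h3 _ hx', h6]
  have hXD : X ⊔ D ≤ N[X] := sup_le Subgroup.le_normalizer hD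
  obtain ⟨W', -, hφW'⟩ := hφ.exists_restrict hXD
  have hW'V : W' ≤ V := by
    obtain ⟨U', -, h3⟩ := hφ.symm.exists_restrict (X := V ⊓ W) inf_le_right
    have hmem : ∀ s, s ∈ U' ↔ φ s ∈ V ⊓ W := fun s => h3.symm.mem_iff.symm
    have : X ⊔ D ≤ U' := by
      refine sup_le (fun x hx => (hmem x).2 ⟨?_, ?_⟩) fun d hd => (hmem d).2 ⟨?_, ?_⟩
      · exact hZV (hgood.1 (hφX.mem_iff.2 hx))
      · exact hφ.mem_iff.2 (Subgroup.le_normalizer hx)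
      · exact hD'V (hφD.mem_iff.2 hd)
      · exact hφ.mem_iff.2 (hD hd)
    exact (hφW'.le_of_le h3.symm this).trans inf_le_left
  obtain ⟨U', -, hτ'⟩ := hτV.exists_restrict hW'V
  refine ⟨τ * φ, X ⊔ D, U', le_sup_left, le_sup_right, hφW'.trans hτ', fun x hx => ?_⟩
  rw [Equiv.Perm.mul_apply, hτQ _ (hφX.mem_iff.2 hx), hβ' x hx]

/-- Saturation at a class that is not centric follows from saturation at all larger subgroups. -/
theorem isSaturatedAt_of_generatedAbove (hS : IsPGroup p S) {X₀ : Subgroup S}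
    (hsat : ∀ R : Subgroup S, Nat.card X₀ < Nat.card R → F.IsSaturatedAt p R)
    (hgen : F.GeneratedAbove X₀) (hnc : ∃ X, F.IsConj X₀ X ∧ ¬ C[X] ≤ X) :
    F.IsSaturatedAt p X₀ := by
  obtain ⟨X₁, hX₁, hnc⟩ := hnc
  have hX₁lt : X₁ < supCentralizer X₁ := lt_of_le_of_ne (le_supCentralizer _) fun heq =>
    hnc ((centralizer_le_supCentralizer X₁).trans heq.ge)
  have hX₀ : X₀ < ⊤ := by
    refine lt_of_le_of_card_lt le_top ?_
    rw [hX₁.card_eq]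
    exact card_lt_of_lt (hX₁lt.trans_le le_top)
  obtain ⟨Q₁, hQ₁, hto₁⟩ := exists_to_of_generatedAbove hS hX₀ hsat hgen
  have hlt₁ : Q₁ < supCentralizer Q₁ := by
    obtain ⟨σ, W, h1, h2, h3⟩ := hto₁ X₁ hX₁
    obtain ⟨U, -, hU⟩ := h3.exists_restrict (supCentralizer_le_normalizer X₁)
    exact (h1.lt_of_lt hU hX₁lt).trans_le
      (h3.le_supCentralizer h1 (supCentralizer_le_normalizer X₁) hU)
  obtain ⟨Z, Q, χ, V, W, hgood, hχZ, hχQ, -, hV, hχV⟩ := exists_good hS (le_supCentralizer Q₁)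
    (hsat _ (hQ₁.card_eq ▸ card_lt_of_lt hlt₁))
  have hNV : N[Q₁] ≤ V := (le_inf (normalizer_le_normalizer_supCentralizer Q₁) le_rfl).trans hV
  have hQ : F.IsConj X₀ Q := hQ₁.trans hχQ.isConj
  have hto : ∀ X, F.IsConj X Q → F.To X Q := fun X hX =>
    (hto₁ X (hQ.trans hX.symm)).trans (To.of_le hχQ hχV hNV)
  -- Z lies in QC(Q), and the map of N(Q) into N(Q₁) embeds QC(Q) into Q₁C(Q₁), which has the order
  -- of Z.
  have hZ : Z = supCentralizer Q := by
    obtain ⟨θ, U, h1, -, h3⟩ := hto₁ Q hQ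
    obtain ⟨U', -, hU'⟩ := h3.exists_restrict (supCentralizer_le_normalizer Q)
    have h4 := Subgroup.card_le_of_le
      (h3.le_supCentralizer h1 (supCentralizer_le_normalizer Q) hU')
    rw [← hU'.card_eq, hχZ.card_eq] at h4
    exact Subgroup.eq_of_le_of_card_ge
      (hχZ.le_supCentralizer hχQ le_rfl hχZ) h4
  subst hZ
  have hQlt : Q < supCentralizer Q := hχQ.lt_of_lt hχZ hlt₁
  have hN := normalizer_le_normalizer_supCentralizer Q
  -- The automorphisms of Q that extend to QC(Q). This contains every automorphism extending to any
  -- larger subgroup, and transport along the generating isomorphisms shows that it is all of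
  -- Aut_F(Q).
  let K : Subgroup (MulAut Q) :=
    { carrier := {α | ∃ τ, F.Iso (supCentralizer Q) (supCentralizer Q) τ ∧ ∀ x : Q, τ x = α x}
      one_mem' := ⟨1, Iso.refl F _, fun x => rfl⟩
      mul_mem' := by
        rintro α β ⟨σ, h1, h2⟩ ⟨τ, h3, h4⟩
        exact ⟨σ * τ, h3.trans h1, fun x => by rw [Equiv.Perm.mul_apply, h4, h2]; rfl⟩
      inv_mem' := by
        rintro α ⟨σ, h1, h2⟩
        refine ⟨σ⁻¹, h1.symm, fun x => ?_⟩
        rw [Equiv.Perm.inv_eq_iff_eq, h2, MulAut.apply_inv_self] }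
  have hcard : Nat.card Q = Nat.card X₀ := hQ.card_eq.symm
  have hK : F.extAut Q ≤ K := by
    rw [extAut, Subgroup.closure_le]
    rintro α ⟨hα, R, R', hR, hR', e, he, h1⟩
    obtain ⟨ρ, hρ⟩ : ∃ ρ : Equiv.Perm S, ∀ x : R, ρ x = e x := by
      obtain ⟨ρ, -, -, -, h⟩ := exists_iso_of_hom he
      exact ⟨ρ, h⟩
    have hρR : F.Iso R R' ρ := ⟨e, he, hρ⟩
    have h2 : ∀ x : Q, ρ x = α x := fun x => (hρ ⟨x, hR.le x.2⟩).trans (h1 x)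
    obtain ⟨U, -, hU⟩ := hρR.exists_restrict (X := R ⊓ N[Q]) inf_le_left
    obtain ⟨τ, h3, h4⟩ := exists_extend_supCentralizer hS hto (fun R hR => hsat R (hcard ▸ hR))
      (Nat.card S) _ U ρ (iso_of_mem_aut hα h2) (hS.lt_inf_normalizer hR) inf_le_right hU
      (Nat.le_add_left _ _)
    exact ⟨τ, h3, fun x => (h4 x x.2).trans (h2 x)⟩
  have hext : ∀ α ∈ F.Aut Q,
      ∃ τ, F.Iso (supCentralizer Q) (supCentralizer Q) τ ∧ ∀ x : Q, τ x = α x := by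
    intro α hα
    have h1 : F.Transports K Q Q (extendAut α) :=
      hgen (F.Transports K) (fun X Y σ τ h hτ => h.congr hτ)
        (fun X Y Z σ τ h h' => h.trans hto h') (fun X Y σ h => h.symm)
        (fun X Y R R' σ _ hXR h hR => Transports.of_extends hS hK h hXR hR) Q Q _ hQ
        (iso_extendAut_iff.2 hα)
    obtain ⟨β, hβ, h2⟩ := h1.exists_mem
    have : α = β := MulEquiv.ext fun x => Subtype.ext (by rw [← h2, extendAut_apply])
    rwa [this]
  exact ⟨Q, hQ, hgood.isFullyAutomized hN hext, hgood.isReceptive hS hN hto hext⟩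

end FusionSystem

/-! ### Centric subgroups, full normalization and strongly p-embedded subgroups of Out -/

namespace FusionSystem

variable {S : Type*} [Group S]

local notation "N[" X "]" => Subgroup.normalizer (X : Set S)
local notation "C[" X "]" => Subgroup.centralizer (X : Set S)

theorem isSCentric_iff {X : Subgroup S} : IsSCentric X ↔ C[X] ≤ X := by
  constructor
  · intro h
    rw [IsSCentric] at h
    rw [h]
    exact Subgroup.map_subtype_le _
  · intro h
    refine le_antisymm (fun s hs => ?_) ?_
    · refine ⟨⟨s, h hs⟩, Subgroup.mem_center_iff.2 fun x => Subtype.ext ?_, rfl⟩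
      exact Subgroup.mem_centralizer_iff.1 hs x x.2
    · rintro _ ⟨z, hz, rfl⟩
      refine Subgroup.mem_centralizer_iff.2 fun x hx => ?_
      exact congrArg Subtype.val (Subgroup.mem_center_iff.1 hz ⟨x, hx⟩)

theorem IsSCentric.mono {X R : Subgroup S} (h : IsSCentric X) (hXR : X ≤ R) : IsSCentric R :=
  isSCentric_iff.2 ((Subgroup.centralizer_le hXR).trans ((isSCentric_iff.1 h).trans hXR))

theorem IsCentric.isSCentric {F : FusionSystem S} {X : Subgroup S} (h : F.IsCentric X) :
    IsSCentric X :=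
  h X (IsConj.refl F X)

theorem IsCentric.of_isConj {F : FusionSystem S} {X Y : Subgroup S} (h : F.IsCentric X)
    (hXY : F.IsConj X Y) : F.IsCentric Y :=
  fun Z hZ => h Z (hXY.trans hZ)

theorem autS_le_extAut_of_lt {F : FusionSystem S} {E : Subgroup S} (hE : E < N[E]) :
    autS E ≤ F.extAut E := by
  intro α hα
  obtain ⟨g, hg, h⟩ := mem_autS_iff.1 hα
  exact mem_extAut_of_iso (autS_le_aut F E hα) (Iso.of_mem_normalizer F (Subgroup.le_normalizer hg))
    hE fun x => (h x).symm

theorem inn_le_autS (E : Subgroup S) : inn E ≤ autS E := by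
  rintro _ ⟨x, rfl⟩
  exact mem_autS_iff.2 ⟨x, Subgroup.le_normalizer x.2, fun z => rfl⟩

theorem mem_of_mem_inn {E : Subgroup S} (hE : IsSCentric E) {α : MulAut E} (hα : α ∈ inn E) {g : S}
    (h : ∀ z : E, (α z : S) = g * z * g⁻¹) : g ∈ E := by
  obtain ⟨x, rfl⟩ := hα
  have h1 : (x : S)⁻¹ * g ∈ E := by
    refine isSCentric_iff.1 hE (Subgroup.mem_centralizer_iff.2 fun z hz => ?_)
    have h2 : (x : S) * z * (x : S)⁻¹ = g * z * g⁻¹ := h ⟨z, hz⟩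
    have h3 : z = (x : S)⁻¹ * (x * z * (x : S)⁻¹) * x := by group
    rw [h2] at h3
    calc z * ((x : S)⁻¹ * g) = (x : S)⁻¹ * (g * z * g⁻¹) * x * ((x : S)⁻¹ * g) := by rw [← h3]
      _ = _ := by group
  simpa using E.mul_mem x.2 h1

theorem not_mem_inn {E : Subgroup S} (hE : IsSCentric E) {g : S} (hg : g ∈ N[E]) (hgE : g ∉ E) :
    E.normalizerMonoidHom ⟨g, hg⟩ ∉ inn E :=
  fun h => hgE (mem_of_mem_inn hE h fun _ => rfl)

theorem isPGroup_inn {p : ℕ} (hS : IsPGroup p S) (E : Subgroup S) : IsPGroup p (inn E) :=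
  (isPGroup_autS hS E).to_le (inn_le_autS E)

variable [Finite S] {F : FusionSystem S} {p : ℕ} [Fact p.Prime]

theorem IsCentric.mono {X R : Subgroup S} (h : F.IsCentric X) (hXR : X ≤ R) : F.IsCentric R := by
  intro R' hR'
  obtain ⟨σ, hσ⟩ := isConj_iff_exists_iso.1 hR'
  obtain ⟨X', hX', hσX⟩ := hσ.exists_restrict hXR
  exact (h X' hσX.isConj).mono hX'

/-- A conjugate with isomorphic normalizer of a fully automized and receptive subgroup is fully
automized and receptive. -/
theorem IsFullyNormalized.isFullyAutomized_and_isReceptive (hS : IsPGroup p S) {Q : Subgroup S}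
    (hQ : F.IsFullyNormalized Q) (hsat : F.IsSaturatedAt p Q) :
    F.IsFullyAutomized p Q ∧ F.IsReceptive Q := by
  obtain ⟨Y, hQY, haut, hrec⟩ := hsat
  obtain ⟨σ, hσ, hσN⟩ := (hQY.to hS haut hrec).exists_iso_normalizer (hQ Y hQY)
  constructor
  · rw [isFullyAutomized_iff] at haut ⊢
    refine ⟨autS_le_aut F Q, isPGroup_autS hS Q, fun D hD hp => ?_⟩
    obtain ⟨e, he, h1⟩ := id hσ
    let f : MulAut Q →* MulAut Y := (MulAut.congr e).toMonoidHom
    have hfi : Function.Injective f := (MulAut.congr e).injective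
    have hf : ∀ (α : MulAut Q) (x : Q), f α (e x) = e (α x) := fun α x => by
      simp [f, MulAut.congr]
    have h2 : D.map f ≤ F.Aut Y := by
      rintro _ ⟨d, hd, rfl⟩
      exact F.comp_mem (F.comp_mem (F.symm_mem he) (hD hd)) he
    have h3 : autS Y ≤ (autS Q).map f := by
      intro α hα
      obtain ⟨g, hg, h3⟩ := mem_autS_iff.1 hα
      have hg' : σ⁻¹ g ∈ N[Q] := hσN.symm.mem_iff.2 hg
      refine ⟨Q.normalizerMonoidHom ⟨_, hg'⟩, ⟨_, rfl⟩, MulEquiv.ext fun y => Subtype.ext ?_⟩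
      obtain ⟨x, rfl⟩ := e.surjective y
      have h4 := hσN.map_conj hg' (Subgroup.le_normalizer x.2)
      rw [perm_apply_inv] at h4
      rw [hf, h3, ← h1, ← h1, ← h4]
      rfl
    have h4 := haut.2.2 _ h2 (hp.map f)
    rw [Subgroup.card_map_of_injective hfi] at h4
    have h5 := Subgroup.card_le_of_le h3
    rw [Subgroup.card_map_of_injective hfi] at h5
    exact h4.trans h5
  · rw [isReceptive_iff] at hrec ⊢
    intro R ρ hρ D hD hc
    obtain ⟨τ, V, W, hRV, hDV, hτ, h1⟩ := hrec R (σ * ρ) (hρ.trans hσ) D hD fun d hd => by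
      obtain ⟨g, hg, h2⟩ := hc d hd
      refine ⟨σ g, hσN.mem_iff.2 hg, fun r hr => ?_⟩
      rw [Equiv.Perm.mul_apply, h2 r hr,
        hσN.map_conj hg (Subgroup.le_normalizer (hρ.mem_iff.2 hr))]
      rfl
    have hRV' : R ≤ V ⊓ N[R] := le_inf hRV Subgroup.le_normalizer
    obtain ⟨W₁, -, hW₁⟩ := hτ.exists_restrict (X := V ⊓ N[R]) inf_le_left
    have hRY : F.Iso R Y τ := (hρ.trans hσ).congr h1
    obtain ⟨W₂, -, hW₂⟩ := hσN.symm.exists_restrict (hW₁.le_normalizer hRY hRV' inf_le_right)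
    refine ⟨σ⁻¹ * τ, _, W₂, hRV', le_inf hDV hD, hW₁.trans hW₂, fun r hr => ?_⟩
    rw [Equiv.Perm.mul_apply, h1 r hr, Equiv.Perm.mul_apply, perm_inv_apply]

theorem exists_isFullyNormalized (F : FusionSystem S) (X : Subgroup S) :
    ∃ Q, F.IsConj X Q ∧ F.IsFullyNormalized Q := by
  obtain ⟨Q, hQ, hmax⟩ := Set.exists_max_image {Y : Subgroup S | F.IsConj X Y}
    (fun Y => Nat.card N[Y]) (Set.toFinite _) ⟨X, IsConj.refl F X⟩
  exact ⟨Q, hQ, fun Y hY => hmax Y (hQ.trans hY)⟩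

theorem lt_normalizer (hS : IsPGroup p S) {E : Subgroup S} (hE : E < ⊤) : E < N[E] := by
  simpa using hS.lt_inf_normalizer hE

/-- An automorphism fusing non-inner elements of `Aut_S(E)` extends to a larger subgroup. -/
theorem IsReceptive.mem_extAut {E : Subgroup S} (hrec : F.IsReceptive E)
    {β x : MulAut E} (hβ : β ∈ F.Aut E) (hx : x ∈ autS E) (hxi : x ∉ inn E)
    (hβx : β * x * β⁻¹ ∈ autS E) : β ∈ F.extAut E := by
  obtain ⟨g, hg, h1⟩ := mem_autS_iff.1 hx
  have hgE : g ∉ E := fun h => hxi ⟨⟨g, h⟩, MulEquiv.ext fun z => Subtype.ext (h1 z).symm⟩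
  have hx' : E.normalizerMonoidHom ⟨g, hg⟩ = x :=
    MulEquiv.ext fun z => Subtype.ext (h1 z).symm
  obtain ⟨τ, V, W, hEV, hDV, hτ, h2⟩ := isReceptive_iff.1 hrec E (extendAut β)
    (iso_extendAut_iff.2 hβ) (Subgroup.zpowers g) (by simpa using hg) (by
      rintro _ ⟨n, rfl⟩
      have h3 : β * x ^ n * β⁻¹ ∈ autS E := by
        rw [← conj_zpow]
        exact zpow_mem hβx n
      obtain ⟨k, hk, h4⟩ := mem_autS_iff.1 h3
      refine ⟨k, hk, fun r hr => ?_⟩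
      have h5 := h4 (β ⟨r, hr⟩)
      rw [extendAut_apply β ⟨r, hr⟩, ← h5, MulAut.mul_apply, MulAut.mul_apply,
        MulAut.inv_apply_self, ← extendAut_apply, ← hx', ← map_zpow]
      rfl)
  have hlt : E < V := lt_of_le_of_ne hEV fun h => hgE (h ▸ hDV (Subgroup.mem_zpowers g))
  exact mem_extAut_of_iso hβ hτ hlt fun x => by rw [h2 x x.2, extendAut_apply]

/-- The subgroup is the image of `F.extAut E`: it contains Aut_S(E), and receptivity in F puts every
automorphism that fuses non-inner elements of Aut_S(E) into it. Two systems are allowed so that this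
serves both F itself and the pruned system. -/
theorem exists_isStronglyPEmbedded (hS : IsPGroup p S) {G : FusionSystem S} {E : Subgroup S}
    (hE : E < ⊤) (hc : IsSCentric E) (haut : F.IsFullyAutomized p E) (hrec : F.IsReceptive E)
    (hGF : G.Aut E ≤ F.Aut E) (hlt : F.extAut E < G.Aut E) :
    ∃ M : Subgroup (G.Out E), IsStronglyPEmbedded p M := by
  have hEN := lt_normalizer hS hE
  have hsyl := ((isFullyAutomized_iff.1 haut).mono (autS_le_aut G E) hGF).subgroupOf
  refine ⟨_, isStronglyPEmbedded_of_controls (Subgroup.isPGroup_subgroupOf (isPGroup_inn hS E))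
    hsyl (H := (F.extAut E).subgroupOf (G.Aut E)) ?_ ?_ ?_ ?_ ?_⟩
  · exact fun x hx => autS_le_extAut_of_lt hEN hx
  · exact fun x hx => autS_le_extAut_of_lt hEN (inn_le_autS E hx)
  · obtain ⟨g, hg, hgE⟩ := SetLike.exists_of_lt hEN
    have hx : E.normalizerMonoidHom ⟨g, hg⟩ ∈ autS E := ⟨_, rfl⟩
    exact ⟨⟨_, autS_le_aut G E hx⟩, hx, not_mem_inn hc hg hgE⟩
  · rw [Ne, Subgroup.subgroupOf_eq_top]
    exact not_le_of_gt hlt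
  · exact fun β x hx hxi hβx => hrec.mem_extAut (hGF β.2) hx hxi hβx

/-- A generator extending to R > E carries the automorphism induced by an element of N_R(E) outside
E to another element of Aut_S(E). That automorphism is not inner because E is S-centric. -/
theorem not_isStronglyPEmbedded (hS : IsPGroup p S) {G : FusionSystem S} {E : Subgroup S}
    (hc : IsSCentric E) (hsyl : IsSylowIn p (autS E) (G.Aut E)) (heq : G.Aut E = F.extAut E)
    (M : Subgroup (G.Out E)) : ¬ IsStronglyPEmbedded p M := by
  let s : Set (MulAut E) := {α | α ∈ F.Aut E ∧
    ∃ (R R' : Subgroup S) (hR : E < R) (_ : E < R') (e : R ≃* R'),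
      e.toMonoidHom ∈ F.Hom R R' ∧
        ∀ x : E, (e (Subgroup.inclusion hR.le x) : S) = α x}
  have hs : Subgroup.closure s = G.Aut E := heq.symm
  refine not_isStronglyPEmbedded_of_closure_eq_top
    (Subgroup.isPGroup_subgroupOf (isPGroup_inn hS E)) hsyl.subgroupOf
    (s := (G.Aut E).subtype ⁻¹' s) ?_ ?_ M
  · apply Subgroup.map_injective (G.Aut E).subtype_injective
    have hsub : s ⊆ Set.range (G.Aut E).subtype := by
      intro α hα
      exact ⟨⟨α, hs ▸ Subgroup.subset_closure hα⟩, rfl⟩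
    rw [MonoidHom.map_closure, Set.image_preimage_eq_of_subset hsub, hs]
    simp [← MonoidHom.range_eq_map]
  · rintro β ⟨hβ, R, R', hR, hR', e, he, h1⟩
    obtain ⟨ρ, -, -, -, hρ⟩ := exists_iso_of_hom he
    have hρR : F.Iso R R' ρ := ⟨e, he, hρ⟩
    have h2 : ∀ x : E, ρ x = β.1 x := fun x => (hρ ⟨x, hR.le x.2⟩).trans (h1 x)
    have hρE : F.Iso E E ρ := iso_of_mem_aut hβ h2
    obtain ⟨g, ⟨hgR, hg⟩, hgE⟩ := SetLike.exists_of_lt (hS.lt_inf_normalizer hR)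
    have hx : E.normalizerMonoidHom ⟨g, hg⟩ ∈ autS E := ⟨_, rfl⟩
    refine ⟨⟨_, autS_le_aut G E hx⟩, hx, not_mem_inn hc hg hgE, ?_⟩
    refine mem_autS_iff.2 ⟨ρ g, (hρR.mem_normalizer_iff hR.le hρE hgR).2 hg, fun z => ?_⟩
    obtain ⟨x, rfl⟩ := β.1.surjective z
    have h3 := hρR.map_conj hgR (hR.le x.2)
    rw [← h2, ← h3]
    change ((β.1 * _ * β.1⁻¹) (β.1 x) : S) = _
    rw [MulAut.mul_apply, MulAut.mul_apply, MulAut.inv_apply_self, ← h2]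
    rfl

end FusionSystem

/-! ### The pruned fusion system -/

namespace FusionSystem

variable {S : Type*} [Group S]

local notation "N[" X "]" => Subgroup.normalizer (X : Set S)
local notation "C[" X "]" => Subgroup.centralizer (X : Set S)

section Prune

variable {F : FusionSystem S} {C : Set (Subgroup S)} {P : Subgroup S} {K : Subgroup (MulAut P)}

theorem mem_prune_top {α : MulAut (⊤ : Subgroup S)} (hα : α ∈ F.Aut ⊤) :
    α ∈ (F.prune C P K).Aut ⊤ :=
  mem_aut_generate (Or.inl (Or.inl ⟨α, hα, rfl⟩))

theorem le_aut_prune : K ≤ (F.prune C P K).Aut P :=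
  fun α hα => mem_aut_generate (Or.inl (Or.inr ⟨α, hα, rfl⟩))

theorem mem_prune_of_mem {E : Subgroup S} (hE : E ∈ C) (hEP : E ≠ P) {α : MulAut E}
    (hα : α ∈ F.Aut E) : α ∈ (F.prune C P K).Aut E :=
  mem_aut_generate (Or.inr (Set.mem_iUnion₂.2 ⟨E, ⟨hE, hEP⟩, α, hα, rfl⟩))

theorem prune_iso_le (hKF : K ≤ F.Aut P) {X Y : Subgroup S} {σ : Equiv.Perm S}
    (h : (F.prune C P K).Iso X Y σ) : F.Iso X Y σ := by
  refine generate_iso_le ?_ h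
  rintro _ ((⟨α, hα, rfl⟩ | ⟨α, hα, rfl⟩) | hx)
  · exact hα
  · exact hKF hα
  · obtain ⟨E, -, α, hα, rfl⟩ := Set.mem_iUnion₂.1 hx
    exact hα

/-- Induction principle for the isomorphisms of `F.prune C P K`. -/
theorem prune_induction (Pr : Subgroup S → Subgroup S → Equiv.Perm S → Prop)
    (htop : ∀ X Y σ, (F.prune C P K).Iso ⊤ ⊤ σ → (F.prune C P K).Iso X Y σ → Pr X Y σ)
    (hK : ∀ α ∈ K, ∀ X ≤ P, ∀ Y, (F.prune C P K).Iso X Y (extendAut α) → Pr X Y (extendAut α))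
    (hE : ∀ E ∈ C, E ≠ P → ∀ X ≤ E, ∀ Y σ, (F.prune C P K).Iso E E σ →
      (F.prune C P K).Iso X Y σ → Pr X Y σ)
    (hcongr : ∀ X Y σ τ, Pr X Y σ → (∀ x ∈ X, τ x = σ x) → Pr X Y τ)
    (htrans : ∀ X Y Z σ τ, Pr X Y σ → Pr Y Z τ → Pr X Z (τ * σ))
    (hsymm : ∀ X Y σ, Pr X Y σ → Pr Y X σ⁻¹) {X Y : Subgroup S} {σ : Equiv.Perm S}
    (h : (F.prune C P K).Iso X Y σ) : Pr X Y σ := by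
  refine generate_induction Pr (fun g X Y hXY => htop X Y _ (Iso.conj _ g (by simp))
    (Iso.conj _ g hXY)) (fun E α hα X hX Y hXY => ?_) hcongr htrans hsymm h
  have hiso : (F.prune C P K).Iso E E (extendAut α) := iso_extendAut_iff.2 (mem_aut_generate hα)
  have hiso' := hiso.restrict hX hXY
  rcases hα with (⟨β, hβ, heq⟩ | ⟨β, hβ, heq⟩) | hα
  · cases heq
    exact htop X Y _ hiso hiso'
  · cases heq
    exact hK _ hβ X hX Y hiso'
  · obtain ⟨E', hE', β, hβ, heq⟩ := Set.mem_iUnion₂.1 hα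
    cases heq
    exact hE _ hE'.1 hE'.2 X hX Y _ hiso hiso'

variable [Finite S] {p : ℕ}

theorem isCentric_top (F : FusionSystem S) : F.IsCentric ⊤ := by
  intro Q hQ
  have : Q = ⊤ := Subgroup.eq_top_of_card_eq _ (by rw [← hQ.card_eq]; exact Subgroup.card_top)
  rw [this]
  exact isSCentric_iff.2 le_top

/-- All generators are automorphisms of F-centric subgroups, so a restriction to a subgroup that is
not F-centric is a restriction to a proper subgroup. -/
theorem generatedAbove_prune (hP : F.IsEssential p P) (hC : F.IsEssentialReps p C)
    (hKF : K ≤ F.Aut P) {X₀ : Subgroup S} (hX₀ : ¬ F.IsCentric X₀) :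
    (F.prune C P K).GeneratedAbove X₀ := by
  intro Pr hcongr htrans hsymm hext X Y σ hX h
  have hnc : ∀ X E, (F.prune C P K).IsConj X₀ X → X ≤ E → F.IsCentric E → X < E := by
    intro X E hX hXE hE
    refine lt_of_le_of_ne hXE ?_
    rintro rfl
    obtain ⟨τ, hτ⟩ := isConj_iff_exists_iso.1 hX
    exact hX₀ (hE.of_isConj (prune_iso_le hKF hτ).isConj.symm)
  refine (prune_induction (F := F) (C := C) (P := P) (K := K)
    (fun X Y σ => (F.prune C P K).Iso X Y σ ∧
      ((F.prune C P K).IsConj X₀ X → Pr X Y σ)) ?_ ?_ ?_ ?_ ?_ ?_ h).2 hX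
  · exact fun X Y σ htop h => ⟨h, fun hX =>
      hext X Y ⊤ ⊤ σ hX (hnc X ⊤ hX le_top (isCentric_top F)) h htop⟩
  · exact fun α hα X hXP Y h => ⟨h, fun hX => hext X Y P P _ hX (hnc X P hX hXP hP.2.1) h
      (iso_extendAut_iff.2 (le_aut_prune hα))⟩
  · exact fun E hE _ X hXE Y σ hσ h => ⟨h, fun hX =>
      hext X Y E E σ hX (hnc X E hX hXE (hC.1 E hE).2.1) h hσ⟩
  · exact fun X Y σ τ h hτ => ⟨h.1.congr hτ, fun hX => hcongr X Y σ τ (h.2 hX) hτ⟩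
  · exact fun X Y Z σ τ h h' => ⟨h.1.trans h'.1, fun hX =>
      htrans X Y Z σ τ (h.2 hX) (h'.2 (hX.trans h.1.isConj))⟩
  · exact fun X Y σ h => ⟨h.1.symm, fun hY => hsymm X Y σ (h.2 (hY.trans h.1.isConj.symm))⟩

variable [Fact p.Prime]

/-- If R were conjugate to P, then X would be carried to a proper subgroup of P, which is S-centric
because X is F-centric. -/
theorem not_isConj_of_le (hmin : ∀ Q : Subgroup S, Q < P → ¬ IsSCentric Q) {X R : Subgroup S}
    (hX : F.IsCentric X) (hXP : ¬ F.IsConj X P) (hXR : X ≤ R) : ¬ F.IsConj R P := by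
  intro h
  obtain ⟨σ, hσ⟩ := isConj_iff_exists_iso.1 h
  obtain ⟨X', hX', hσX⟩ := hσ.exists_restrict hXR
  refine hmin X' (lt_of_le_of_ne hX' ?_) (hX X' hσX.isConj)
  rintro rfl
  exact hXP hσX.isConj

theorem IsFullyNormalized.to {E X : Subgroup S} (hE : F.IsFullyNormalized E)
    (hS : IsPGroup p S) (hF : F.IsSaturated p) (h : F.IsConj X E) : F.To X E := by
  obtain ⟨haut, hrec⟩ := hE.isFullyAutomized_and_isReceptive hS (hF E)
  exact h.to hS haut hrec

/-- `F` and `F.prune C P K` agree on the `F`-centric subgroups that are not conjugate to `P`. -/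
theorem prune_iso_of_isCentric (hS : IsPGroup p S) (hF : F.IsSaturated p)
    (hC : F.IsEssentialReps p C) (hmin : ∀ Q : Subgroup S, Q < P → ¬ IsSCentric Q) (n : ℕ) :
    ∀ (X Y : Subgroup S) (σ : Equiv.Perm S), Nat.card S ≤ Nat.card X + n → F.IsCentric X →
      ¬ F.IsConj X P → F.Iso X Y σ → (F.prune C P K).Iso X Y σ := by
  have htop : ∀ (Y : Subgroup S) (σ : Equiv.Perm S), F.Iso ⊤ Y σ →
      (F.prune C P K).Iso ⊤ Y σ := by
    intro Y σ h
    have hY : Y = ⊤ := Subgroup.eq_top_of_card_eq _ (by rw [← h.card_eq]; exact Subgroup.card_top)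
    subst hY
    obtain ⟨α, hα, h1⟩ := h.exists_aut
    exact iso_of_mem_aut (mem_prune_top hα) h1
  induction n with
  | zero =>
    intro X Y σ hn _ _ h
    have : X = ⊤ := Subgroup.eq_top_of_le_card _ hn
    subst this
    exact htop Y σ h
  | succ n ih =>
    intro X Y σ hn hX hXP h
    rcases eq_or_ne X ⊤ with rfl | hXtop
    · exact htop Y σ h
    obtain ⟨E, hXE, hEN, hE⟩ : ∃ E, F.IsConj X E ∧ F.IsFullyNormalized E ∧
        (E ∈ C ∨ ¬ F.IsEssential p E) := by
      obtain ⟨E, hXE, hEN⟩ := exists_isFullyNormalized F X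
      by_cases hE : F.IsEssential p E
      · obtain ⟨E', ⟨hE', hEE'⟩, -⟩ := hC.2 E hE
        exact ⟨E', hXE.trans hEE', (hC.1 E' hE').2.2.1, Or.inl hE'⟩
      · exact ⟨E, hXE, hEN, Or.inr hE⟩
    -- The inductive hypothesis, in the form used below: an isomorphism in the class of X that
    -- extends to a larger subgroup already lies in the pruned system.
    have hlarge : ∀ X' Y' R R' τ, F.IsConj X X' → X' < R → F.Iso R R' τ → F.Iso X' Y' τ →
        (F.prune C P K).Iso X' Y' τ := by
      intro X' Y' R R' τ hX' hlt hR hτ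
      have hc := card_lt_of_lt hlt
      have hX'c := hX.of_isConj hX'
      rw [← hX'.card_eq] at hc
      refine (ih R R' τ (by omega) (hX'c.mono hlt.le)
        (not_isConj_of_le hmin hX'c (fun h => hXP (hX'.trans h)) hlt.le) hR).restrict hlt.le
        fun s => hτ.mem_iff
    have hlt : ∀ X', F.IsConj X X' → X' < ⊤ := fun X' hX' =>
      lt_of_le_of_card_lt le_top
        (hX'.card_eq ▸ card_lt_of_lt (lt_top_iff_ne_top.2 hXtop))
    have hto : ∀ X', F.IsConj X X' → ∃ τ, F.Iso X' E τ ∧ (F.prune C P K).Iso X' E τ := by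
      intro X' hX'
      obtain ⟨τ, W, h1, -, h3⟩ := hEN.to hS hF (hX'.symm.trans hXE)
      exact ⟨τ, h1, hlarge _ _ _ _ _ hX' (lt_normalizer hS (hlt X' hX')) h3 h1⟩
    obtain ⟨σ₁, h1, h1'⟩ := hto X (IsConj.refl F X)
    obtain ⟨σ₂, h2, h2'⟩ := hto Y h.isConj
    have hE' : F.Aut E ≤ (F.prune C P K).Aut E := by
      rcases hE with hE | hE
      · exact fun α hα => mem_prune_of_mem hE (by rintro rfl; exact hXP hXE) hα
      · have hext : F.extAut E = F.Aut E := by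
          -- Otherwise the extendable automorphisms would give a strongly p-embedded subgroup, and E
          -- would be essential.
          by_contra hne
          obtain ⟨haut, hrec⟩ := hEN.isFullyAutomized_and_isReceptive hS (hF E)
          have hEc := hX.of_isConj hXE
          exact hE ⟨hlt E hXE, hEc, hEN, exists_isStronglyPEmbedded hS (hlt E hXE)
            hEc.isSCentric haut hrec le_rfl (lt_of_le_of_ne (extAut_le_aut F E) hne)⟩
        rw [← hext, extAut, Subgroup.closure_le]
        rintro α ⟨hα, R, R', hR, -, e, he, h3⟩
        obtain ⟨ρ, -, -, -, hρ⟩ := exists_iso_of_hom he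
        have h4 : ∀ x : E, ρ x = α x := fun x => (hρ ⟨x, hR.le x.2⟩).trans (h3 x)
        refine iso_extendAut_iff.1 ((hlarge E E R R' ρ hXE hR ⟨e, he, hρ⟩
          (iso_of_mem_aut hα h4)).congr fun x hx => ?_)
        rw [extendAut_apply α ⟨x, hx⟩, h4 ⟨x, hx⟩]
    obtain ⟨α, hα, h3⟩ := ((h1.symm.trans h).trans h2).exists_aut
    have h4 := (h1'.trans (iso_of_mem_aut (hE' hα) h3)).trans h2'.symm
    exact h4.congr fun x _ => by simp

theorem prune_iso (hS : IsPGroup p S) (hF : F.IsSaturated p)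
    (hC : F.IsEssentialReps p C) (hmin : ∀ Q : Subgroup S, Q < P → ¬ IsSCentric Q)
    {X Y : Subgroup S} {σ : Equiv.Perm S} (hX : F.IsCentric X)
    (hXP : ¬ F.IsConj X P) (h : F.Iso X Y σ) : (F.prune C P K).Iso X Y σ :=
  prune_iso_of_isCentric hS hF hC hmin (Nat.card S) X Y σ (Nat.le_add_left _ _) hX hXP h

theorem not_isConj_of_isConj_of_lt {X R : Subgroup S} (hX : F.IsConj X P) (hXR : X < R) :
    ¬ F.IsConj R P := fun h =>
  (card_lt_of_lt hXR).ne (hX.card_eq.trans h.card_eq.symm)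

/-- All `F`-conjugates of `P` are conjugate to `P` in `F.prune C P K`. -/
theorem prune_to (hS : IsPGroup p S) (hF : F.IsSaturated p) (hP : F.IsEssential p P)
    (hC : F.IsEssentialReps p C) (hmin : ∀ Q : Subgroup S, Q < P → ¬ IsSCentric Q)
    {X : Subgroup S} (hX : F.IsConj X P) : (F.prune C P K).To X P := by
  obtain ⟨σ, W, h1, h2, h3⟩ := hP.2.2.1.to hS hF hX
  have hlt : X < N[X] := lt_normalizer hS
    (lt_of_le_of_card_lt le_top (hX.card_eq ▸ card_lt_of_lt hP.1))
  have h4 : (F.prune C P K).Iso N[X] W σ := prune_iso hS hF hC hmin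
    ((hP.2.1.of_isConj hX.symm).mono hlt.le) (not_isConj_of_isConj_of_lt hX hlt) h3
  exact ⟨σ, W, h4.restrict hlt.le fun s => h1.mem_iff, h2, h4⟩

/-- Every generator transports to an element of K. Restrictions of automorphisms of S or of another
representative E to conjugates of P extend properly, because `hC` excludes conjugacy of E to P. -/
theorem aut_prune (hS : IsPGroup p S) (hF : F.IsSaturated p) (hP : F.IsEssential p P)
    (hC : F.IsEssentialReps p C) (hPC : P ∈ C) (hHK : F.extAut P ≤ K) (hKF : K ≤ F.Aut P) :
    (F.prune C P K).Aut P = K := by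
  refine le_antisymm (fun α hα => ?_) le_aut_prune
  have hnot : ∀ X Y σ, (F.prune C P K).Iso X Y σ → (F.IsConj X P → F.Transports K X Y σ) →
      F.Transports K X Y σ := by
    intro X Y σ h h1
    -- Outside the class of P, the transport condition is vacuous.
    by_cases hX : F.IsConj X P
    · exact h1 hX
    · exact ⟨prune_iso_le hKF h, fun χ χ' W W' h2 => (hX h2.isConj).elim⟩
  have htr : F.Transports K P P (extendAut α) := by
    refine prune_induction (C := C) (P := P) (K := K) (F.Transports K) ?_ ?_ ?_
      (fun X Y σ τ h hτ => h.congr hτ)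
      (fun X Y Z σ τ h h' => h.trans (fun X hX => hP.2.2.1.to hS hF hX) h')
      (fun X Y σ h => h.symm) (iso_extendAut_iff.2 hα)
    · intro X Y σ htop h
      refine hnot X Y σ h fun hX => ?_
      exact Transports.of_extends hS hHK (prune_iso_le hKF h)
        (lt_of_le_of_card_lt le_top (hX.card_eq ▸ card_lt_of_lt hP.1)) (prune_iso_le hKF htop)
    · intro β hβ X hXP Y h
      refine hnot X Y _ h fun hX => ?_
      have hXeq : X = P := Subgroup.eq_of_le_of_card_ge hXP hX.card_eq.ge
      subst hXeq
      have hYeq := (prune_iso_le hKF h).right_unique (iso_extendAut_iff.2 (hKF hβ))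
      subst hYeq
      exact Transports.of_mem hS hP.1 hHK hKF hβ
    · intro E hE hEP X hXE Y σ hσE h
      refine hnot X Y σ h fun hX => ?_
      refine Transports.of_extends hS hHK (prune_iso_le hKF h) (lt_of_le_of_ne hXE ?_)
        (prune_iso_le hKF hσE)
      rintro rfl
      exact hEP ((hC.2 X (hC.1 X hE)).unique ⟨hE, IsConj.refl F X⟩ ⟨hPC, hX⟩)
  obtain ⟨β, hβ, h⟩ := htr.exists_mem
  have : α = β := MulEquiv.ext fun x => Subtype.ext (by rw [← h, extendAut_apply])
  rwa [this]

/-- Subgroups that are centric in `F.prune C P K` are centric in `F`. -/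
theorem isCentric_of_isCentric_prune (hS : IsPGroup p S) (hF : F.IsSaturated p)
    (hP : F.IsEssential p P) (hC : F.IsEssentialReps p C)
    (hmin : ∀ Q : Subgroup S, Q < P → ¬ IsSCentric Q) (n : ℕ) :
    ∀ X : Subgroup S, Nat.card S ≤ Nat.card X + n → (F.prune C P K).IsCentric X →
      F.IsCentric X := by
  induction n with
  | zero =>
    intro X hn _
    rw [Subgroup.eq_top_of_le_card X hn]
    exact isCentric_top F
  | succ n ih =>
    intro X hn hX
    rcases eq_or_ne X ⊤ with rfl | hXtop
    · exact isCentric_top F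
    have hlt : X < N[X] := lt_normalizer hS (lt_top_iff_ne_top.2 hXtop)
    have hcard := card_lt_of_lt hlt
    have hN : F.IsCentric N[X] := ih _ (by omega) (hX.mono hlt.le)
    -- A map N(X) → P in the pruned system would carry X to a proper S-centric subgroup of P.
    have hNP : ¬ F.IsConj N[X] P := by
      intro h
      obtain ⟨σ, -, hσ, -, -⟩ := prune_to (K := K) hS hF hP hC hmin h
      obtain ⟨X', -, hσX⟩ := hσ.exists_restrict hlt.le
      exact hmin X' (hσX.lt_of_lt hσ hlt) (hX X' hσX.isConj)
    obtain ⟨E, hXE, hEN⟩ := exists_isFullyNormalized F X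
    obtain ⟨σ, W, h1, -, h3⟩ := hEN.to hS hF hXE
    have h4 : (F.prune C P K).Iso N[X] W σ := prune_iso hS hF hC hmin hN hNP h3
    -- X → E extends to N(X), hence lies in the pruned system, where X is centric. Any F-conjugate Y
    -- then inherits the property from E, along a map defined on N(Y) ≥ C(Y).
    have hE : C[E] ≤ E := isSCentric_iff.1
      (hX E (h4.restrict hlt.le fun s => h1.mem_iff).isConj)
    intro Y hY
    obtain ⟨τ, U, h5, -, h6⟩ := hEN.to hS hF (hY.symm.trans hXE)
    refine isSCentric_iff.2 fun s hs => h5.mem_iff.1 (hE ?_)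
    exact (h6.mem_centralizer_iff Subgroup.le_normalizer h5
      (Subgroup.centralizer_le_normalizer _ hs)).2 hs

/-- The representative used for F works again. Aut_S stays Sylow in the smaller automorphism group.
Extensions supplied by F lie in the pruned system by `prune_iso`, except in the class of P when the
domain does not grow, where the given map is its own extension. -/
theorem isSaturatedAt_prune_of_isCentric (hS : IsPGroup p S) (hF : F.IsSaturated p)
    (hP : F.IsEssential p P) (hC : F.IsEssentialReps p C)
    (hmin : ∀ Q : Subgroup S, Q < P → ¬ IsSCentric Q) (hKF : K ≤ F.Aut P) {X : Subgroup S}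
    (hX : F.IsCentric X) : (F.prune C P K).IsSaturatedAt p X := by
  by_cases hXP : F.IsConj X P
  · obtain ⟨haut, hrec⟩ := hP.2.2.1.isFullyAutomized_and_isReceptive hS (hF P)
    refine ⟨P, (prune_to hS hF hP hC hmin hXP).isConj, ?_, ?_⟩
    · rw [isFullyAutomized_iff] at haut ⊢
      exact haut.mono (autS_le_aut _ P) fun α hα =>
        iso_extendAut_iff.1 (prune_iso_le hKF (iso_extendAut_iff.2 hα))
    · rw [isReceptive_iff] at hrec ⊢
      intro R σ hσ D hD hc
      have hσF := prune_iso_le hKF hσ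
      obtain ⟨τ, V, W, hRV, hDV, hτ, h1⟩ := hrec R σ hσF D hD hc
      rcases hRV.eq_or_lt with rfl | hlt
      · exact ⟨σ, R, P, le_rfl, hDV, hσ, fun _ _ => rfl⟩
      · exact ⟨τ, V, W, hRV, hDV, prune_iso hS hF hC hmin
          ((hP.2.1.of_isConj hσF.isConj.symm).mono hRV)
          (not_isConj_of_isConj_of_lt hσF.isConj hlt) hτ, h1⟩
  · obtain ⟨Q, hXQ, haut, hrec⟩ := hF X
    obtain ⟨σ, hσ⟩ := isConj_iff_exists_iso.1 hXQ
    refine ⟨Q, (prune_iso hS hF hC hmin hX hXP hσ).isConj, ?_, ?_⟩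
    · rw [isFullyAutomized_iff] at haut ⊢
      exact haut.mono (autS_le_aut _ Q) fun α hα =>
        iso_extendAut_iff.1 (prune_iso_le hKF (iso_extendAut_iff.2 hα))
    · rw [isReceptive_iff] at hrec ⊢
      intro R ρ hρ D hD hc
      have hρF := prune_iso_le hKF hρ
      obtain ⟨τ, V, W, hRV, hDV, hτ, h1⟩ := hrec R ρ hρF D hD hc
      have hXR : F.IsConj X R := hXQ.trans hρF.isConj.symm
      have hRc := hX.of_isConj hXR
      exact ⟨τ, V, W, hRV, hDV, prune_iso hS hF hC hmin (hRc.mono hRV)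
        (not_isConj_of_le hmin hRc (fun h => hXP (hXR.trans h)) hRV) hτ, h1⟩

theorem isSaturated_prune (hS : IsPGroup p S) (hF : F.IsSaturated p)
    (hP : F.IsEssential p P) (hC : F.IsEssentialReps p C)
    (hmin : ∀ Q : Subgroup S, Q < P → ¬ IsSCentric Q) (hKF : K ≤ F.Aut P) :
    (F.prune C P K).IsSaturated p := by
  -- The inequality is strict so that the case n = 0 is empty and S itself is treated in the
  -- inductive step.
  have key : ∀ n : ℕ, ∀ X : Subgroup S, Nat.card S < Nat.card X + n →
      (F.prune C P K).IsSaturatedAt p X := by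
    intro n
    induction n with
    | zero =>
      intro X hn
      exact absurd hn (not_lt_of_ge (Subgroup.card_le_card_group X))
    | succ n ih =>
      intro X hn
      by_cases hX : F.IsCentric X
      · exact isSaturatedAt_prune_of_isCentric hS hF hP hC hmin hKF hX
      refine isSaturatedAt_of_generatedAbove hS (fun R hR => ih R (by omega))
        (generatedAbove_prune hP hC hKF hX) ?_
      by_contra hcon
      refine hX (isCentric_of_isCentric_prune (K := K) hS hF hP hC hmin (Nat.card S) X
        (Nat.le_add_left _ _) fun Y hY => isSCentric_iff.2 ?_)
      by_contra hYc
      exact hcon ⟨Y, hY, hYc⟩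
  exact fun X => key (Nat.card S + 1) X (by omega)

end Prune

end FusionSystem

theorem lemma5 (p : ℕ) [Fact p.Prime] {S : Type*} [Group S] [Finite S] (hS : IsPGroup p S)
    (F : FusionSystem S) (hF : F.IsSaturated p)
    (P : Subgroup S) (hP : F.IsEssential p P)
    (C : Set (Subgroup S)) (hC : F.IsEssentialReps p C) (hPC : P ∈ C)
    (hmin : ∀ Q : Subgroup S, Q < P → ¬ FusionSystem.IsSCentric Q)
    (K : Subgroup (MulAut P)) (hHK : F.extAut P ≤ K) (hKF : K ≤ F.Aut P) :
    (F.prune C P K).IsSaturated p ∧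
      ((F.prune C P K).IsEssential p P ↔ F.extAut P < K) ∧
      ((F.prune C P K).IsEssential p P → (F.prune C P K).Aut P = K) := by
  have hK : (F.prune C P K).Aut P = K := FusionSystem.aut_prune hS hF hP hC hPC hHK hKF
  obtain ⟨haut, hrec⟩ := hP.2.2.1.isFullyAutomized_and_isReceptive hS (hF P)
  have hPc : FusionSystem.IsSCentric P := hP.2.1.isSCentric
  have hconj : ∀ Q, (F.prune C P K).IsConj P Q → F.IsConj P Q := fun Q hQ => by
    obtain ⟨σ, hσ⟩ := FusionSystem.isConj_iff_exists_iso.1 hQ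
    exact (FusionSystem.prune_iso_le hKF hσ).isConj
  refine ⟨FusionSystem.isSaturated_prune hS hF hP hC hmin hKF, ⟨fun h => ?_, fun h => ?_⟩,
    fun _ => hK⟩
  · refine lt_of_le_of_ne hHK fun heq => ?_
    obtain ⟨M, hM⟩ := h.2.2.2
    refine FusionSystem.not_isStronglyPEmbedded hS hPc ?_ (hK.trans heq.symm) M hM
    exact (FusionSystem.isFullyAutomized_iff.1 haut).mono (FusionSystem.autS_le_aut _ P)
      (hK.le.trans hKF)
  -- Centricity and full normalization pass to the smaller system, which has fewer conjugates of P.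
  · exact ⟨hP.1, fun Q hQ => hP.2.1 Q (hconj Q hQ), fun Q hQ => hP.2.2.1 Q (hconj Q hQ),
      FusionSystem.exists_isStronglyPEmbedded hS hP.1 hPc haut hrec (hK.le.trans hKF)
        (hK.symm ▸ h)⟩
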